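/- Let $G=\mathbb C\ltimes\mathbb C^2$ be $\mathbb C^3$ with the product $$(a_1,a_2,a_3)\cdot(z_1,z_2,z_3)=(z_1+a_1,\;e^{-a_1}z_2+a_2,\;e^{a_1}z_3+a_3),$$ let $\Gamma\subset G$ be a lattice (a discrete cocompact subgroup) with $e^{\gamma_1-\overline{\gamma_1}}=1$ for all $\gamma=(\gamma_1,\gamma_2,\gamma_3)\in\Gamma$, and let $M=\Gamma\backslash G$ (the holomorphically parallelizable Nakamura manifold of type III-(3b)). Put $\varphi^1=dz_1$, $\varphi^2=e^{z_1}dz_2$, $\varphi^3=e^{-z_1}dz_3$, with dual frame $\theta_1,\theta_2,\theta_3$, and $$\widetilde\varphi^1=\overline{\varphi^1},\quad \widetilde\varphi^2=e^{z_1-\overline{z_1}}\,\overline{\varphi^2},\quad \widetilde\varphi^3=e^{\overline{z_1}-z_1}\,\overline{\varphi^3},\qquad \psi(t)=\sum_{i,\lambda=1}^3 t_{i\lambda}\,\widetilde\varphi^\lambda\otimes\theta_i,\quad t=(t_{i\lambda})\in\mathbb C^{3\times 3}.$$ For small $t$ let $J_t$ be the almost complex structure on $M$ whose $(1,0)$-forms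 are spanned by $\varphi^i+\psi(t)\lrcorner\varphi^i=\varphi^i+\sum_\lambda t_{i\lambda}\widetilde\varphi^\lambda$, $i=1,2,3$. Consider the classes - (1): $t_{11}\neq0$, $t_{12}=t_{13}=t_{23}=t_{32}=0$; - (3): $t_{12}\neq0$, $t_{11}=t_{13}=t_{21}=t_{23}=t_{31}=0$; - (4): $t_{13}\neq0$, $t_{11}=t_{12}=t_{21}=t_{31}=t_{32}=0$. Then there is $\varepsilon>0$ such that for every $t$ with $|t_{i\lambda}|<\varepsilon$ for all $i,\lambda$ and belonging to one of these classes the following hold. (a) $J_t$ is a well-defined integrable complex structure on $M$; write $M_t=(M,J_t)$. The forms $\varphi_t^i=\varphi^i+\psi(t)\lrcorner\varphi^i-\kappa_i\,(\varphi^1+\psi(t)\lrcorner\varphi^1)$, with $\kappa=(0,t_{21}/t_{11},t_{31}/t_{11})$ in class (1), $\kappa=(0,0,t_{32}/t_{12})$ in class (3) and $\kappa=(0,t_{23}/t_{13},0)$ in class (4), are a global smooth coframe of $(1,0)$-forms on $M_t$. (b) $M_t$ admits a balanced metric: the diagonal Hermitian metric $\sum_i\varphi_t^i\odot\overline{\varphi_t^i}$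 has fundamental form $\omega_t$ with $d\omega_t^2=0$. (c) $M_t$ admits no SKT metric: there is no smooth Hermitian metric on $M_t$, invariant or not, whose fundamental form $\omega$ satisfies $\partial\overline\partial\omega=0$ with respect to $J_t$. (d) With $j=2$ in classes (1) and (3) and $j=3$ in class (4), there is a constant $C>0$ such that $$\partial\overline\partial\big(\varphi_t^j\wedge\overline{\varphi_t^j}\big)=-C\,\varphi_t^1\wedge\varphi_t^j\wedge\overline{\varphi_t^1}\wedge\overline{\varphi_t^j},$$ so the positive $(2,2)$-form $-\varphi_t^1\wedge\varphi_t^j\wedge\overline{\varphi_t^1}\wedge\overline{\varphi_t^j}$ is $\partial\overline\partial$-exact. (e) In classes (3) and (4) the complex structure $J_t$ on the solvmanifold $\Gamma\backslash G$ is not invariant, that is, it is not induced by a left-invariant almost complex structure on $G$. -/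

import Mathlib

open scoped ContDiff

noncomputable section

namespace Nakamura

/-! ### The group and its compact quotients -/

/-- The model space `ℂ³`, regarded as a real vector space of dimension six. Its tangent spaces are
identified with `ℂ³` itself by means of the coordinates `z₁, z₂, z₃` (indexed by `0, 1, 2`). -/
abbrev E : Type := Fin 3 → ℂ

/-- The solvable complex Lie group `ℂ ⋉ ℂ²`, with underlying complex manifold `ℂ³`. -/
def G : Type := E

instance : TopologicalSpace G := inferInstanceAs (TopologicalSpace E)

/-- Left translation by `a`:
`(z₁, z₂, z₃) ↦ (z₁ + a₁, e^{-a₁} z₂ + a₂, e^{a₁} z₃ + a₃)`. -/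
def leftMul (a : G) (z : E) : E :=
  ![a 0 + z 0, Complex.exp (-(a 0)) * z 1 + a 1, Complex.exp (a 0) * z 2 + a 2]

instance : Mul G := ⟨fun a b => leftMul a b⟩

instance : One G := ⟨fun _ => (0 : ℂ)⟩

instance : Inv G :=
  ⟨fun a => (![-(a 0), -(Complex.exp (a 0) * a 1), -(Complex.exp (-(a 0)) * a 2)] : E)⟩

instance : Group G :=
  Group.ofLeftAxioms
    (by
      intro a b c
      change leftMul (leftMul a b) c = leftMul a (leftMul b c)
      funext i
      fin_cases i <;> simp [leftMul, Complex.exp_add] <;> ring)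
    (by
      intro a
      change leftMul (fun _ => (0 : ℂ)) a = a
      funext i
      fin_cases i <;> simp [leftMul])
    (by
      intro a
      change leftMul (![-(a 0), -(Complex.exp (a 0) * a 1), -(Complex.exp (-(a 0)) * a 2)] : E) a =
        fun _ => (0 : ℂ)
      funext i
      fin_cases i <;> simp [leftMul])

/-- The quotient `Γ \ G` by left translations. -/
abbrev Solvmanifold (Γ : Subgroup G) : Type := Quotient (MulAction.orbitRel Γ G)

/-- `Γ \ G` is a holomorphically parallelizable Nakamura manifold of type III-(3b): `Γ` is a lattice
(discrete and cocompact) and `exp (z₁ - conj z₁)` is a function on `Γ \ G`. -/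
structure IsNakamuraLattice (Γ : Subgroup G) : Prop where
  discrete : DiscreteTopology Γ
  cocompact : CompactSpace (Solvmanifold Γ)
  exp_eq_one : ∀ γ ∈ Γ, Complex.exp (γ 0 - starRingEnd ℂ (γ 0)) = 1

/-! ### Complex-valued differential forms

`G` is the universal covering of `Γ \ G`, and smooth tensor fields on `Γ \ G` are the smooth tensor
fields on `G = ℂ³` which are invariant under the left translations by elements of `Γ`. -/

/-- Complex-valued differential `k`-forms on `ℂ³`. -/
abbrev Form (k : ℕ) : Type := E → E [⋀^Fin k]→L[ℝ] ℂ

/-- The differential at `z` of the left translation by `a`. -/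
def dLeft (a : G) (z : E) : E →L[ℝ] E := fderiv ℝ (leftMul a) z

/-- The tensor product `(v₁, …, v_{k+l}) ↦ α(v₁, …, v_k) β(v_{k+1}, …, v_{k+l})`. -/
def tensor {k l : ℕ} (α : E [⋀^Fin k]→L[ℝ] ℂ) (β : E [⋀^Fin l]→L[ℝ] ℂ) :
    ContinuousMultilinearMap ℝ (fun _ : Fin (k + l) => E) ℂ where
  toFun v := α (fun i => v (Fin.castAdd l i)) * β (fun j => v (Fin.natAdd k j))
  map_update_add' := by
    intro _ v i x y
    have hd : (‹DecidableEq (Fin (k + l))›) = instDecidableEqFin (k + l) := Subsingleton.elim _ _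
    subst hd
    refine Fin.addCases (fun i => ?_) (fun i => ?_) i
    · have h1 : ∀ w : E, (fun j => Function.update v (Fin.castAdd l i) w (Fin.castAdd l j))
          = Function.update (fun j => v (Fin.castAdd l j)) i w := by
        intro w; funext j; by_cases h : j = i
        · subst h; simp
        · rw [Function.update_of_ne h, Function.update_of_ne]
          intro h'; exact h (Fin.castAdd_injective _ _ h')
      have h2 : ∀ w : E, (fun j => Function.update v (Fin.castAdd l i) w (Fin.natAdd k j))
          = fun j => v (Fin.natAdd k j) := by
        intro w; funext j
        rw [Function.update_of_ne]
        intro h'; have := congrArg Fin.val h'; simp at this; omega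
      simp only [h1, h2, α.map_update_add]; ring
    · have h1 : ∀ w : E, (fun j => Function.update v (Fin.natAdd k i) w (Fin.natAdd k j))
          = Function.update (fun j => v (Fin.natAdd k j)) i w := by
        intro w; funext j; by_cases h : j = i
        · subst h; simp
        · rw [Function.update_of_ne h, Function.update_of_ne]
          intro h'; exact h (Fin.natAdd_injective _ _ h')
      have h2 : ∀ w : E, (fun j => Function.update v (Fin.natAdd k i) w (Fin.castAdd l j))
          = fun j => v (Fin.castAdd l j) := by
        intro w; funext j
        rw [Function.update_of_ne]
        intro h'; have := congrArg Fin.val h'; simp at this; omega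
      simp only [h1, h2, β.map_update_add]; ring
  map_update_smul' := by
    intro _ v i c x
    have hd : (‹DecidableEq (Fin (k + l))›) = instDecidableEqFin (k + l) := Subsingleton.elim _ _
    subst hd
    refine Fin.addCases (fun i => ?_) (fun i => ?_) i
    · have h1 : ∀ w : E, (fun j => Function.update v (Fin.castAdd l i) w (Fin.castAdd l j))
          = Function.update (fun j => v (Fin.castAdd l j)) i w := by
        intro w; funext j; by_cases h : j = i
        · subst h; simp
        · rw [Function.update_of_ne h, Function.update_of_ne]
          intro h'; exact h (Fin.castAdd_injective _ _ h')
      have h2 : ∀ w : E, (fun j => Function.update v (Fin.castAdd l i) w (Fin.natAdd k j))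
          = fun j => v (Fin.natAdd k j) := by
        intro w; funext j
        rw [Function.update_of_ne]
        intro h'; have := congrArg Fin.val h'; simp at this; omega
      simp only [h1, h2, α.map_update_smul, smul_mul_assoc]
    · have h1 : ∀ w : E, (fun j => Function.update v (Fin.natAdd k i) w (Fin.natAdd k j))
          = Function.update (fun j => v (Fin.natAdd k j)) i w := by
        intro w; funext j; by_cases h : j = i
        · subst h; simp
        · rw [Function.update_of_ne h, Function.update_of_ne]
          intro h'; exact h (Fin.natAdd_injective _ _ h')
      have h2 : ∀ w : E, (fun j => Function.update v (Fin.natAdd k i) w (Fin.castAdd l j))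
          = fun j => v (Fin.castAdd l j) := by
        intro w; funext j
        rw [Function.update_of_ne]
        intro h'; have := congrArg Fin.val h'; simp at this; omega
      simp only [h1, h2, β.map_update_smul, mul_smul_comm]
  cont := by
    refine Continuous.mul ?_ ?_
    · exact α.cont.comp (continuous_pi fun i => continuous_apply _)
    · exact β.cont.comp (continuous_pi fun i => continuous_apply _)

/-- The wedge product, normalized so that `(α ∧ β)(v, w) = α(v) β(w) - α(w) β(v)` for `1`-forms
(the normalization for which `d` is the usual exterior derivative). -/
def wedge {k l : ℕ} (α : E [⋀^Fin k]→L[ℝ] ℂ) (β : E [⋀^Fin l]→L[ℝ] ℂ) :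
    E [⋀^Fin (k + l)]→L[ℝ] ℂ :=
  ((k.factorial * l.factorial : ℝ)⁻¹) • (tensor α β).alternatization

/-- A covector as an alternating form of degree one. -/
def oneForm (α : E →L[ℝ] ℂ) : E [⋀^Fin 1]→L[ℝ] ℂ :=
  ContinuousAlternatingMap.ofSubsingleton ℝ E ℂ (0 : Fin 1) α

/-- The complex conjugate of a form. -/
def conjForm {k : ℕ} (α : E [⋀^Fin k]→L[ℝ] ℂ) : E [⋀^Fin k]→L[ℝ] ℂ :=
  (Complex.conjCLE : ℂ →L[ℝ] ℂ).compContinuousAlternatingMap α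

/-! ### Almost complex structures, types, `∂` and `∂̄` -/

/-- Fields of real endomorphisms of the tangent spaces. -/
abbrev EndField : Type := E → E →L[ℝ] E

/-- `J` is invariant under the left translations by elements of `Γ`. -/
def IsInvariant (Γ : Subgroup G) (J : EndField) : Prop :=
  ∀ a ∈ Γ, ∀ z, (J (leftMul a z)).comp (dLeft a z) = (dLeft a z).comp (J z)

/-- `J` is a complex structure on `Γ \ G`: a smooth almost complex structure, invariant under `Γ`,
such that around each point there are `J`-holomorphic local coordinates. -/
structure IsComplexStructure (Γ : Subgroup G) (J : EndField) : Prop where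
  smooth : ContDiff ℝ ∞ J
  sq : ∀ z v, J z (J z v) = -v
  invariant : IsInvariant Γ J
  integrable : ∀ z, ∃ ζ : E → E, ContDiffAt ℝ ∞ ζ z ∧ Function.Bijective (fderiv ℝ ζ z) ∧
    ∀ᶠ y in nhds z, ∀ v, fderiv ℝ ζ y (J y v) = Complex.I • fderiv ℝ ζ y v

/-- `J` is left-invariant: it is invariant under all left translations of `G`. -/
def IsLeftInvariant (J : EndField) : Prop := IsInvariant ⊤ J

/-- The rotation `cos θ + sin θ J`. It acts by `e^{i(p-q)θ}` on forms of type `(p,q)`. -/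
def rotation (J : E →L[ℝ] E) (θ : ℝ) : E →L[ℝ] E :=
  Real.cos θ • ContinuousLinearMap.id ℝ E + Real.sin θ • J

/-- The component of type `(p,q)` of a form of degree `k = p + q` with respect to `J`, that is, the
projection onto the forms on which the rotations act by `e^{i(p-q)θ}`. As `p - q` runs over
`-k, -k + 2, …, k`, it is enough to average over the angles `θ = π j / (k + 1)`, `0 ≤ j ≤ k`. -/
def typePart (J : E →L[ℝ] E) (p q : ℕ) {k : ℕ} (α : E [⋀^Fin k]→L[ℝ] ℂ) :
    E [⋀^Fin k]→L[ℝ] ℂ :=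
  ((k + 1 : ℂ)⁻¹) • ∑ j ∈ Finset.range (k + 1),
    Complex.exp (-(((p : ℂ) - (q : ℂ)) * (Real.pi * j / (k + 1)) * Complex.I)) •
      α.compContinuousLinearMap (rotation J (Real.pi * j / (k + 1)))

/-- `∂` on forms of type `(p,q)`: the component of type `(p+1,q)` of the exterior derivative. -/
def del (J : EndField) (p q : ℕ) {k : ℕ} (α : Form k) : Form (k + 1) :=
  fun z => typePart (J z) (p + 1) q (extDeriv α z)

/-- `∂̄` on forms of type `(p,q)`: the component of type `(p,q+1)` of the exterior derivative. -/
def delbar (J : EndField) (p q : ℕ) {k : ℕ} (α : Form k) : Form (k + 1) :=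
  fun z => typePart (J z) p (q + 1) (extDeriv α z)

/-- `∂∂̄` on `2`-forms of type `(1,1)`. -/
def delDelbar (J : EndField) (α : Form 2) : Form 4 := del J 1 2 (delbar J 1 1 α)

/-! ### Hermitian metrics -/

/-- A smooth Hermitian metric `g` on `(Γ \ G, J)`, with its fundamental form `ω = g(J·, ·)`. -/
structure HermitianMetric (Γ : Subgroup G) (J : EndField) where
  g : E → E →L[ℝ] E →L[ℝ] ℝ
  smooth : ContDiff ℝ ∞ g
  symm : ∀ z v w, g z v w = g z w v
  pos : ∀ z v, v ≠ 0 → 0 < g z v v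
  compatible : ∀ z v w, g z (J z v) (J z w) = g z v w
  invariant : ∀ a ∈ Γ, ∀ z v w, g (leftMul a z) (dLeft a z v) (dLeft a z w) = g z v w
  fundForm : Form 2
  fundForm_apply : ∀ z v w, fundForm z ![v, w] = (g z (J z v) w : ℂ)

/-- Balanced metrics in complex dimension three: `dω² = 0`. -/
def HermitianMetric.IsBalanced {Γ : Subgroup G} {J : EndField} (h : HermitianMetric Γ J) : Prop :=
  ∀ z, extDeriv (fun y => wedge (h.fundForm y) (h.fundForm y)) z = 0

/-- SKT metrics: `∂∂̄ω = 0`. -/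
def HermitianMetric.IsSKT {Γ : Subgroup G} {J : EndField} (h : HermitianMetric Γ J) : Prop :=
  ∀ z, delDelbar J h.fundForm z = 0

/-- `φ` is a global smooth coframe of `(1,0)`-forms on `(Γ \ G, J)`. -/
structure IsCoframe (Γ : Subgroup G) (J : EndField) (φ : Fin 3 → E → E →L[ℝ] ℂ) : Prop where
  smooth : ∀ i, ContDiff ℝ ∞ (φ i)
  invariant : ∀ i, ∀ a ∈ Γ, ∀ z, (φ i (leftMul a z)).comp (dLeft a z) = φ i z
  type_one_zero : ∀ i z v, φ i z (J z v) = Complex.I * φ i z v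
  linearIndependent : ∀ z, LinearIndependent ℂ (fun i => φ i z)

/-- `h` is the diagonal metric `∑ᵢ φⁱ ⊙ conj φⁱ` of the coframe `φ`. -/
def HermitianMetric.IsDiagonal {Γ : Subgroup G} {J : EndField} (h : HermitianMetric Γ J)
    (φ : Fin 3 → E → E →L[ℝ] ℂ) : Prop :=
  ∀ z v w, h.g z v w = (∑ i, φ i z v * starRingEnd ℂ (φ i z w)).re

/-! ### The deformations -/

/-- The left-invariant holomorphic coframe `φ¹ = dz₁`, `φ² = e^{z₁} dz₂`, `φ³ = e^{-z₁} dz₃`. -/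
def phi (i : Fin 3) (z : E) : E →L[ℝ] ℂ :=
  (![1, Complex.exp (z 0), Complex.exp (-(z 0))] : Fin 3 → ℂ) i •
    (ContinuousLinearMap.proj i : E →L[ℝ] ℂ)

/-- The dual frame `θ₁ = ∂/∂z₁`, `θ₂ = e^{-z₁} ∂/∂z₂`, `θ₃ = e^{z₁} ∂/∂z₃`. -/
def theta (i : Fin 3) (z : E) : E :=
  Pi.single i ((![1, Complex.exp (-(z 0)), Complex.exp (z 0)] : Fin 3 → ℂ) i)

/-- The `(0,1)`-forms `conj φ¹`, `e^{z₁ - conj z₁} conj φ²`, `e^{conj z₁ - z₁} conj φ³`. -/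
def phiTilde (l : Fin 3) (z : E) : E →L[ℝ] ℂ :=
  (![1, Complex.exp (z 0 - starRingEnd ℂ (z 0)), Complex.exp (starRingEnd ℂ (z 0) - z 0)] :
      Fin 3 → ℂ) l • (Complex.conjCLE : ℂ →L[ℝ] ℂ).comp (phi l z)

/-- The `(0,1)`-form with values in the holomorphic tangent bundle (here `ℂ³`)
`ψ(t) = ∑ t_{iλ} φ̃^λ ⊗ θᵢ`. -/
def psi (t : Matrix (Fin 3) (Fin 3) ℂ) (z : E) : E →L[ℝ] E :=
  ∑ i, ∑ l, (phiTilde l z).smulRight (t i l • theta i z)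

/-- The map `1 + ψ(t)`, whose components are the forms `dz_i + ψ(t) ⌟ dz_i`. -/
def beltrami (t : Matrix (Fin 3) (Fin 3) ℂ) (z : E) : E →L[ℝ] E :=
  ContinuousLinearMap.id ℝ E + psi t z

/-- The complex structure of the deformation `M_t`, for small `t`: the one whose `(1,0)`-forms are
spanned by the forms `dz_i + ψ(t) ⌟ dz_i`. Thus a function `f` is holomorphic for it if and only if
`(∂̄ - ψ(t)) f = 0`. -/
def deformedJ (t : Matrix (Fin 3) (Fin 3) ℂ) : EndField := fun z =>
  (beltrami t z).inverse.comp (Complex.I • beltrami t z)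

/-- Nakamura's classes (1), (3), (4) of small deformations. -/
inductive DefClass
  | one
  | three
  | four

/-- The parameters `t = (t_{iλ})` which belong to each class (indices are shifted by one). -/
def DefClass.Mem : DefClass → Matrix (Fin 3) (Fin 3) ℂ → Prop
  | .one, t => t 0 0 ≠ 0 ∧ t 0 1 = 0 ∧ t 0 2 = 0 ∧ t 1 2 = 0 ∧ t 2 1 = 0
  | .three, t => t 0 1 ≠ 0 ∧ t 0 0 = 0 ∧ t 0 2 = 0 ∧ t 1 0 = 0 ∧ t 1 2 = 0 ∧ t 2 0 = 0
  | .four, t => t 0 2 ≠ 0 ∧ t 0 0 = 0 ∧ t 0 1 = 0 ∧ t 1 0 = 0 ∧ t 2 0 = 0 ∧ t 2 1 = 0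

/-- The forms `φⁱ + ψ(t) ⌟ φⁱ = φⁱ + ∑ t_{iλ} φ̃^λ`. -/
def phiT (t : Matrix (Fin 3) (Fin 3) ℂ) (i : Fin 3) (z : E) : E →L[ℝ] ℂ :=
  (phi i z).comp (beltrami t z)

/-- The coefficients `κ` of the coframe `φ_tⁱ = φⁱ + ψ(t) ⌟ φⁱ - κᵢ (φ¹ + ψ(t) ⌟ φ¹)`. -/
def DefClass.shift : DefClass → Matrix (Fin 3) (Fin 3) ℂ → Fin 3 → ℂ
  | .one, t => ![0, t 1 0 / t 0 0, t 2 0 / t 0 0]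
  | .three, t => ![0, 0, t 2 1 / t 0 1]
  | .four, t => ![0, t 1 2 / t 0 2, 0]

/-- The `(1,0)`-coframe `φ_t¹, φ_t², φ_t³` of `M_t` adapted to each class. -/
def DefClass.coframe (c : DefClass) (t : Matrix (Fin 3) (Fin 3) ℂ) (i : Fin 3) (z : E) :
    E →L[ℝ] ℂ :=
  phiT t i z - c.shift t i • phiT t 0 z

/-- The index `j` for which `φ_t^j ∧ conj φ_t^j` gives the obstruction: `φ_t²` for classes (1) and
(3), `φ_t³` for class (4). -/
def DefClass.obstructionIndex : DefClass → Fin 3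
  | .one => 1
  | .three => 1
  | .four => 2

end Nakamura

end

open Nakamura

/-!
The coframe adapted to each class has the form `φᵢ = e^{wᵢ z₁} dζᵢ` with real weights `wᵢ`, equal to
`(0, 1, -1)`, `(1, 1, -1)` and `(-1, 1, -1)` in classes (1), (3) and (4), for explicit smooth
functions `ζᵢ` on `ℂ³`. This is the notion of a weighted frame (`IsWeightedFrame`), established in
`DefClass.isWeightedFrame`. The functions `ζᵢ` are holomorphic coordinates for `J_t`, which gives
integrability, and the structure equations are `dφᵢ = wᵢ dz₁ ∧ φᵢ`.

*Balanced metrics.* The form `φᵢ ∧ φ̄ᵢ ∧ φⱼ ∧ φ̄ⱼ` has derivative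
`(wᵢ + wⱼ) (dz₁ + dz̄₁) ∧ φᵢ ∧ φ̄ᵢ ∧ φⱼ ∧ φ̄ⱼ`. For `i ≠ j`, either the weights cancel or `dz₁` is a
combination of `φᵢ, φ̄ᵢ, φⱼ, φ̄ⱼ` (`DefClass.isBalancing`), so that `ω²` is closed for the diagonal
metric.

*The obstruction.* For the index `j` of the statement, `wⱼ = ±1`, and modulo `φⱼ` and `φ̄ⱼ` one has
`dz₁ ≡ b φ₁ + c φ̄₁` with constants such that `a = b + c̄` is nonzero and `w₁ c = 0`
(`IsObstructing`). Hence `d(φⱼ ∧ φ̄ⱼ ∧ β) = wⱼ (a φ₁ + ā φ̄₁) ∧ φⱼ ∧ φ̄ⱼ ∧ β + φⱼ ∧ φ̄ⱼ ∧ dβ`, and a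
second differentiation yields `∂∂̄(φⱼ ∧ φ̄ⱼ) = |a|² φ₁ ∧ φ̄₁ ∧ φⱼ ∧ φ̄ⱼ`.

*No SKT metrics.* If `∂∂̄ω = 0`, the `Γ`-invariant `5`-form
`φⱼ ∧ φ̄ⱼ ∧ ∂̄ω + wⱼ a φ₁ ∧ φⱼ ∧ φ̄ⱼ ∧ ω` has derivative `-|a|² φ₁ ∧ φ̄₁ ∧ φⱼ ∧ φ̄ⱼ ∧ ω`, a nowhere
vanishing real form of top degree; this contradicts Stokes' theorem on the compact quotient
(`IsWeightedFrame.not_isSKT`). The version of Stokes' theorem needed here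
(`exists_extDeriv_eq_zero`) requires neither a fundamental domain nor an integral on the quotient:
since `G` is amenable, there are cutoff functions on `G` whose left-invariant derivatives are small
in `L¹` relative to their integral, and the theorem for compactly supported forms on `ℂ³` is applied
to the product of the `5`-form with such a function.

*Non-invariance.* In classes (3) and (4) the coefficient of `φ̄ʲ` in `φ_t¹`, with respect to the
left-invariant frame, is a nonzero multiple of `e^{±(z₁ - z̄₁)}`. If `J_t` were left-invariant,
comparing the points with `z₁ = 0` and `z₁ = iπ/2` would make `φ̄ʲ` a form of type `(1,0)`; as
`φ_tʲ` is a combination of `φʲ` and `φ̄ʲ`, also `φʲ` would be of type `(1,0)`, which is absurd.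
-/

noncomputable section

namespace Nakamura

/-! ### Exterior multiplication by covectors -/

/-- Complex-valued alternating forms of degree `k` on the tangent space. -/
abbrev Alt (k : ℕ) : Type := E [⋀^Fin k]→L[ℝ] ℂ

/-- The exterior product `θ ∧ α` of a covector with a `k`-form. -/
def covWedge {k : ℕ} (θ : E →L[ℝ] ℂ) (α : Alt k) : Alt (k + 1) :=
  .alternatizeUncurryFin (((ContinuousLinearMap.lsmul ℝ ℂ).flip α).comp θ)

/-- The complex conjugate of a covector. -/
def conjCov (θ : E →L[ℝ] ℂ) : E →L[ℝ] ℂ := (Complex.conjCLE : ℂ →L[ℝ] ℂ).comp θ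

@[simp] lemma conjCov_apply (θ : E →L[ℝ] ℂ) (v : E) :
    conjCov θ v = starRingEnd ℂ (θ v) := rfl

section Algebra

@[simp] lemma alt_smul_zero {k : ℕ} (c : ℂ) : c • (0 : Alt k) = 0 := smul_zero (A := Alt k) c

variable {k : ℕ} (θ η : E →L[ℝ] ℂ) (α β : Alt k)

lemma covWedge_apply (v : Fin (k + 1) → E) :
    covWedge θ α v = ∑ i : Fin (k + 1), (-1 : ℂ) ^ (i : ℕ) * (θ (v i) * α (i.removeNth v)) := by
  simp [covWedge, ContinuousAlternatingMap.alternatizeUncurryFin_apply, ContinuousLinearMap.lsmul]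

lemma covWedge_add : covWedge θ (α + β) = covWedge θ α + covWedge θ β := by
  ext v; simp [covWedge_apply, mul_add, Finset.sum_add_distrib]

lemma covWedge_smul (c : ℂ) : covWedge θ (c • α) = c • covWedge θ α := by
  ext v; simp [covWedge_apply, Finset.mul_sum]; congr 1; ext; ring

lemma add_covWedge : covWedge (θ + η) α = covWedge θ α + covWedge η α := by
  ext v; simp [covWedge_apply, mul_add, add_mul, Finset.sum_add_distrib]

lemma smul_covWedge (c : ℂ) : covWedge (c • θ) α = c • covWedge θ α := by
  ext v; simp [covWedge_apply, Finset.mul_sum]; congr 1; ext; ring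

/-- Exterior multiplication by a covector, as a linear map. -/
def covWedgeₗ (k : ℕ) (θ : E →L[ℝ] ℂ) : Alt k →ₗ[ℂ] Alt (k + 1) where
  toFun := covWedge θ
  map_add' := covWedge_add θ
  map_smul' c α := covWedge_smul θ α c

@[simp] lemma covWedge_zero : covWedge θ (0 : Alt k) = 0 := map_zero (covWedgeₗ k θ)

@[simp] lemma zero_covWedge : covWedge 0 α = 0 := by
  ext v; simp [covWedge_apply]

lemma covWedge_neg : covWedge θ (-α) = -covWedge θ α := map_neg (covWedgeₗ k θ) α

lemma covWedge_sub : covWedge θ (α - β) = covWedge θ α - covWedge θ β :=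
  map_sub (covWedgeₗ k θ) α β

@[simp] lemma covWedge_self : covWedge θ (covWedge θ α) = 0 := by
  have h := ContinuousAlternatingMap.alternatizeUncurryFin_alternatizeUncurryFinCLM_comp_of_symmetric
    (f := (((ContinuousLinearMap.compL ℝ E ℂ (Alt k)).flip θ).comp
      ((ContinuousLinearMap.lsmul ℝ ℂ (E := Alt k)).flip.comp
        (((ContinuousLinearMap.lsmul ℝ ℂ).flip α).comp θ)))) (by
      intro x y
      simp [smul_smul, mul_comm])
  rw [← h]
  unfold covWedge
  congr 1
  ext x v
  simp [ContinuousAlternatingMap.alternatizeUncurryFin_apply, Finset.mul_sum]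
  congr 1; ext i; ring

lemma covWedge_anticomm : covWedge θ (covWedge η α) = -covWedge η (covWedge θ α) := by
  have h := covWedge_self (θ + η) α
  simp only [add_covWedge, covWedge_add, covWedge_self, zero_add, add_zero] at h
  exact eq_neg_of_add_eq_zero_right h

@[simp] lemma covWedge_covWedge_self : covWedge θ (covWedge η (covWedge θ α)) = 0 := by
  rw [covWedge_anticomm η, covWedge_neg, covWedge_self, neg_zero]

lemma covWedge_comp (L : E →L[ℝ] E) : (covWedge θ α).compContinuousLinearMap L =
    covWedge (θ.comp L) (α.compContinuousLinearMap L) := by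
  ext v; simp only [covWedge_apply, ContinuousAlternatingMap.compContinuousLinearMap_apply]
  rfl

lemma norm_covWedge_le : ‖covWedge θ α‖ ≤ (k + 1) * (‖θ‖ * ‖α‖) := by
  refine (ContinuousAlternatingMap.norm_alternatizeUncurryFin_le _).trans ?_
  gcongr
  refine ContinuousLinearMap.opNorm_le_bound _ (by positivity) fun v => ?_
  simp only [ContinuousLinearMap.comp_apply, ContinuousLinearMap.flip_apply,
    ContinuousLinearMap.lsmul_apply, norm_smul]
  nlinarith [θ.le_opNorm v, norm_nonneg α]

end Algebra

section Smooth
variable {k : ℕ}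

lemma two_le_infty : (2 : WithTop ℕ∞) ≤ ∞ :=
  WithTop.coe_le_coe.2 (le_top (a := (2 : ℕ∞)))

lemma contDiff_covWedge {n : WithTop ℕ∞} {θ : E → E →L[ℝ] ℂ} {α : Form k} (hθ : ContDiff ℝ n θ)
    (hα : ContDiff ℝ n α) : ContDiff ℝ n fun z => covWedge (θ z) (α z) := by
  have h : ContDiff ℝ n fun z => ((ContinuousLinearMap.lsmul ℝ ℂ).flip (α z)).comp (θ z) :=
    ContDiff.clm_comp ((ContinuousLinearMap.contDiff _).comp hα) hθ
  exact (ContinuousAlternatingMap.alternatizeUncurryFinCLM ℝ E ℂ).contDiff.comp h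

lemma contDiff_conjCov {n : WithTop ℕ∞} {θ : E → E →L[ℝ] ℂ} (hθ : ContDiff ℝ n θ) :
    ContDiff ℝ n fun z => conjCov (θ z) := contDiff_const.clm_comp hθ

lemma contDiff_extDeriv {α : Form k} (hα : ContDiff ℝ ∞ α) : ContDiff ℝ ∞ (extDeriv α) :=
  (ContinuousAlternatingMap.alternatizeUncurryFinCLM ℝ E ℂ).contDiff.comp
    (hα.fderiv_right (by simp))

lemma extDeriv_smul_form {f : E → ℂ} {α : Form k} {z : E} (hf : DifferentiableAt ℝ f z)
    (hα : DifferentiableAt ℝ α z) : extDeriv (fun y => f y • α y) z =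
      covWedge (fderiv ℝ f z) (α z) + f z • extDeriv α z := by
  unfold extDeriv covWedge
  rw [fderiv_fun_smul hf hα, ContinuousAlternatingMap.alternatizeUncurryFin_add,
    ← ContinuousAlternatingMap.alternatizeUncurryFin_smul]
  exact add_comm (G := Alt (k + 1)) _ _

lemma extDeriv_const_smul_form {α : Form k} {z : E} (c : ℂ) (hα : DifferentiableAt ℝ α z) :
    extDeriv (fun y => c • α y) z = c • extDeriv α z := by
  rw [extDeriv_smul_form (by fun_prop) hα]; simp

lemma extDeriv_covWedge_fderiv {g : E → ℂ} {α : Form k} (hg : ContDiff ℝ ∞ g)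
    (hα : ContDiff ℝ ∞ α) (z : E) : extDeriv (fun y => covWedge (fderiv ℝ g y) (α y)) z =
      -covWedge (fderiv ℝ g z) (extDeriv α z) := by
  have hdg : ContDiff ℝ ∞ (fderiv ℝ g) := hg.fderiv_right (by simp)
  have h1 : extDeriv (fun y => g y • α y) =
      fun y => covWedge (fderiv ℝ g y) (α y) + g y • extDeriv α y := funext fun y =>
    extDeriv_smul_form (hg.differentiable (by simp) y) (hα.differentiable (by simp) y)
  have h2 := congrFun (extDeriv_extDeriv (hg.smul hα) (by simpa using two_le_infty)) z
  have h3 := congrFun (extDeriv_extDeriv hα (by simpa using two_le_infty)) z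
  have e : (g • α) = fun y => g y • α y := rfl
  rw [e, h1] at h2
  erw [extDeriv_fun_add ((contDiff_covWedge hdg hα).differentiable (by simp) z)
    ((hg.smul (contDiff_extDeriv hα)).differentiable (by simp) z),
    extDeriv_smul_form (hg.differentiable (by simp) z)
      ((contDiff_extDeriv hα).differentiable (by simp) z), h3] at h2
  simpa using eq_neg_of_add_eq_zero_left h2

/-- A form-valued function is smooth as soon as its values on fixed tangent vectors are: such
values on a basis determine the form linearly. -/
lemma contDiff_form_of_apply {n : WithTop ℕ∞} {α : Form k}
    (h : ∀ v, ContDiff ℝ n fun z => α z v) : ContDiff ℝ n α := by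
  let b := Module.finBasis ℝ E
  let T : Alt k →ₗ[ℝ] ((Fin k → Fin (Module.finrank ℝ E)) → ℂ) :=
    { toFun := fun α r => α fun i => b (r i)
      map_add' := fun _ _ => rfl
      map_smul' := fun _ _ => rfl }
  have hT : Function.Injective T := by
    intro α β hαβ
    apply ContinuousAlternatingMap.toAlternatingMap_injective
    exact Module.Basis.ext_alternating b fun r _ => congrFun hαβ r
  obtain ⟨S, hS⟩ := T.exists_leftInverse_of_injective (LinearMap.ker_eq_bot.2 hT)
  have e : α = fun z => LinearMap.toContinuousLinearMap S (T (α z)) :=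
    funext fun z => (LinearMap.congr_fun hS (α z)).symm
  rw [e]
  exact (ContinuousLinearMap.contDiff _).comp (contDiff_pi.2 fun r => h _)

lemma contDiff_form_apply {n : WithTop ℕ∞} : ∀ {k : ℕ} {α : Form k} {v : Fin k → E → E},
    ContDiff ℝ n α → (∀ i, ContDiff ℝ n (v i)) → ContDiff ℝ n fun z => α z fun i => v i z := by
  intro k
  induction k with
  | zero =>
    intro α v hα _
    have e : (fun z => α z fun i => v i z) = fun z => α z ![] := by
      funext z; congr 1; exact Subsingleton.elim _ _
    rw [e]
    exact (ContinuousAlternatingMap.apply ℝ E ℂ ![]).contDiff.comp hα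
  | succ k ih =>
    intro α v hα hv
    have e : (fun z => α z fun i => v i z) =
        fun z => ((α z).curryLeft (v 0 z)) fun i => v i.succ z := by
      funext z
      rw [ContinuousAlternatingMap.curryLeft_apply_apply]
      congr 1
      funext i
      refine Fin.cases rfl (fun i => rfl) i
    rw [e]
    refine ih ?_ fun i => hv i.succ
    refine ContDiff.clm_apply ?_ (hv 0)
    exact (LinearIsometry.contDiff (F := E →L[ℝ] Alt k)
      ContinuousAlternatingMap.curryLeftLI).comp hα

lemma contDiff_compForm {n : WithTop ℕ∞} {α : Form k} {L : E → E →L[ℝ] E} (hα : ContDiff ℝ n α)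
    (hL : ContDiff ℝ n L) : ContDiff ℝ n fun z => (α z).compContinuousLinearMap (L z) :=
  contDiff_form_of_apply fun v =>
    contDiff_form_apply (v := fun i z => L z (v i)) hα fun _ => hL.clm_apply contDiff_const

end Smooth

/-! ### The wedge product, types of forms, and top degree -/

section Wedge

/-- The constant `1` as a form of degree zero. -/
def altOne : Alt 0 := ContinuousAlternatingMap.constOfIsEmpty ℝ E (Fin 0) 1

@[simp] lemma altOne_apply (v : Fin 0 → E) : altOne v = 1 := rfl

lemma covWedge_altOne (θ : E →L[ℝ] ℂ) : covWedge θ altOne = oneForm θ := by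
  ext v; simp [covWedge_apply, oneForm]

/-- Laplace expansion: exterior products of covectors are given by determinants. -/
lemma covWedge_apply_eq_det {k : ℕ} {α : Alt k} {θ : Fin k → E →L[ℝ] ℂ}
    (h : ∀ v, α v = Matrix.det (Matrix.of fun i j => θ i (v j))) (η : E →L[ℝ] ℂ)
    (v : Fin (k + 1) → E) : covWedge η α v =
      Matrix.det (Matrix.of fun i j => (Matrix.vecCons η θ : Fin (k + 1) → E →L[ℝ] ℂ) i (v j)) := by
  rw [Matrix.det_succ_row_zero, covWedge_apply]
  refine Finset.sum_congr rfl fun i _ => ?_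
  rw [h, mul_assoc]
  rfl

lemma covWedge_four_apply (a b c d : E →L[ℝ] ℂ) (v : Fin 4 → E) :
    covWedge a (covWedge b (covWedge c (covWedge d altOne))) v =
      Matrix.det (Matrix.of fun i j => (![a, b, c, d] : Fin 4 → E →L[ℝ] ℂ) i (v j)) :=
  covWedge_apply_eq_det (covWedge_apply_eq_det (covWedge_apply_eq_det
    (covWedge_apply_eq_det (θ := ![]) (by simp) d) c) b) a v

lemma oneForm_apply (a : E →L[ℝ] ℂ) (v : Fin 1 → E) : oneForm a v = a (v 0) := rfl

lemma wedge_apply {k l : ℕ} (α : Alt k) (β : Alt l) (v : Fin (k + l) → E) :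
    wedge α β v = ((k.factorial * l.factorial : ℝ)⁻¹) •
      ∑ σ : Equiv.Perm (Fin (k + l)), Equiv.Perm.sign σ • tensor α β (v ∘ σ) := by
  simp only [wedge, ContinuousAlternatingMap.smul_apply,
    ContinuousMultilinearMap.alternatization_apply_apply]

lemma wedge_oneForm_apply (a b : E →L[ℝ] ℂ) (v : Fin 2 → E) :
    wedge (oneForm a) (oneForm b) v = a (v 0) * b (v 1) - a (v 1) * b (v 0) := by
  rw [wedge_apply]
  have h := Matrix.det_apply (Matrix.of fun i j => (![a, b] : Fin 2 → E →L[ℝ] ℂ) j (v i))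
  rw [Matrix.det_fin_two] at h
  have e : ∀ σ : Equiv.Perm (Fin 2), (tensor (oneForm a) (oneForm b)) (v ∘ σ) =
      ∏ i, (Matrix.of fun i j => (![a, b] : Fin 2 → E →L[ℝ] ℂ) j (v i)) (σ i) i := by
    intro σ
    rw [Fin.prod_univ_two]
    rfl
  simp only [Nat.factorial_one, Nat.cast_one, mul_one, inv_one, one_smul]
  rw [Finset.sum_congr rfl fun σ _ => congrArg _ (e σ), ← h]
  simp
  ring

lemma wedge_oneForm (a b : E →L[ℝ] ℂ) :
    wedge (oneForm a) (oneForm b) = covWedge a (covWedge b altOne) := by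
  ext v
  rw [wedge_oneForm_apply, covWedge_altOne, covWedge_apply]
  simp [Fin.sum_univ_two, oneForm_apply, Fin.removeNth]
  ring

lemma conjForm_wedge_oneForm (a b : E →L[ℝ] ℂ) : conjForm (wedge (oneForm a) (oneForm b)) =
    wedge (oneForm (conjCov a)) (oneForm (conjCov b)) := by
  ext v
  simp [conjForm, wedge_oneForm_apply]

lemma wedge_wedge_oneForm (a b c d : E →L[ℝ] ℂ) :
    wedge (wedge (oneForm a) (oneForm b)) (wedge (oneForm c) (oneForm d)) =
      covWedge a (covWedge b (covWedge c (covWedge d altOne))) := by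
  ext v
  have key : ∀ w : Fin 4 → E, ∑ σ : Equiv.Perm (Fin 4), Equiv.Perm.sign σ •
      (a (w (σ 0)) * b (w (σ 1)) * (c (w (σ 2)) * d (w (σ 3)))) =
      covWedge a (covWedge b (covWedge c (covWedge d altOne))) w := by
    intro w
    rw [covWedge_four_apply, ← Matrix.det_transpose, Matrix.det_apply]
    refine Finset.sum_congr rfl fun σ _ => ?_
    congr 1
    simp [Fin.prod_univ_four]; ring
  have h1 : ∀ σ : Equiv.Perm (Fin 4),
      tensor (wedge (oneForm a) (oneForm b)) (wedge (oneForm c) (oneForm d)) (v ∘ σ) =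
        a (v (σ 0)) * b (v (σ 1)) * (c (v (σ 2)) * d (v (σ 3)))
        - a (v (σ 1)) * b (v (σ 0)) * (c (v (σ 2)) * d (v (σ 3)))
        - a (v (σ 0)) * b (v (σ 1)) * (c (v (σ 3)) * d (v (σ 2)))
        + a (v (σ 1)) * b (v (σ 0)) * (c (v (σ 3)) * d (v (σ 2))) := by
    intro σ
    change wedge (oneForm a) (oneForm b) (fun i : Fin 2 => v (σ (Fin.castAdd 2 i))) *
      wedge (oneForm c) (oneForm d) (fun i : Fin 2 => v (σ (Fin.natAdd 2 i))) = _
    rw [wedge_oneForm_apply, wedge_oneForm_apply]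
    change (a (v (σ 0)) * b (v (σ 1)) - a (v (σ 1)) * b (v (σ 0))) *
      (c (v (σ 2)) * d (v (σ 3)) - c (v (σ 3)) * d (v (σ 2))) = _
    ring
  have hperm : ∀ (τ : Equiv.Perm (Fin 4)), ∑ σ : Equiv.Perm (Fin 4), Equiv.Perm.sign σ •
      (a (v (σ (τ 0))) * b (v (σ (τ 1))) * (c (v (σ (τ 2))) * d (v (σ (τ 3))))) =
      (Equiv.Perm.sign τ) • covWedge a (covWedge b (covWedge c (covWedge d altOne))) v := by
    intro τ
    rw [← key, Finset.smul_sum]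
    refine Fintype.sum_equiv (Equiv.mulRight τ) _ _ fun σ => ?_
    simp [smul_smul, mul_comm, Equiv.Perm.mul_apply]
    rw [← mul_assoc (Equiv.Perm.sign τ), Int.units_mul_self, one_mul]
  rw [wedge_apply]
  rw [Finset.sum_congr rfl fun σ _ => congrArg _ (h1 σ)]
  have h01 := hperm (Equiv.swap 0 1)
  have h23 := hperm (Equiv.swap 2 3)
  have hb := hperm (Equiv.swap 0 1 * Equiv.swap 2 3)
  have n1 : (Equiv.swap 0 1 : Equiv.Perm (Fin 4)) 2 = 2 := by decide
  have n2 : (Equiv.swap 0 1 : Equiv.Perm (Fin 4)) 3 = 3 := by decide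
  have n3 : (Equiv.swap 2 3 : Equiv.Perm (Fin 4)) 0 = 0 := by decide
  have n4 : (Equiv.swap 2 3 : Equiv.Perm (Fin 4)) 1 = 1 := by decide
  simp only [Equiv.Perm.mul_apply, Equiv.swap_apply_left, Equiv.swap_apply_right, n1, n2, n3, n4,
    Equiv.Perm.sign_mul, Equiv.Perm.sign_swap (show (0 : Fin 4) ≠ 1 by decide),
    Equiv.Perm.sign_swap (show (2 : Fin 4) ≠ 3 by decide)] at h01 h23 hb
  simp only [smul_add, smul_sub, Finset.sum_add_distrib, Finset.sum_sub_distrib, h01, h23, hb, key]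
  simp
  ring

lemma wedge_add {k l : ℕ} (α : Alt k) (β γ : Alt l) :
    wedge α (β + γ) = wedge α β + wedge α γ := by
  have : tensor α (β + γ) = tensor α β + tensor α γ := by
    ext v; exact mul_add _ _ _
  rw [wedge, this, map_add, smul_add]; rfl

lemma add_wedge {k l : ℕ} (α β : Alt k) (γ : Alt l) :
    wedge (α + β) γ = wedge α γ + wedge β γ := by
  have : tensor (α + β) γ = tensor α γ + tensor β γ := by
    ext v; exact add_mul _ _ _
  rw [wedge, this, map_add, smul_add]; rfl

end Wedge

section TypePart

variable {k : ℕ} {J : E →L[ℝ] E}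

lemma comp_rotation {θ : E →L[ℝ] ℂ} (h : ∀ v, θ (J v) = Complex.I * θ v) (s : ℝ) :
    θ.comp (rotation J s) = Complex.exp (s * Complex.I) • θ := by
  ext v
  simp [rotation, h, Complex.exp_mul_I]
  ring

lemma conjCov_comp_rotation {θ : E →L[ℝ] ℂ} (h : ∀ v, θ (J v) = Complex.I * θ v) (s : ℝ) :
    (conjCov θ).comp (rotation J s) = Complex.exp (-(s * Complex.I)) • conjCov θ := by
  ext v
  have := congrArg (starRingEnd ℂ) (DFunLike.congr_fun (comp_rotation h s) v)
  simpa [← Complex.exp_conj] using this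

/-- A linear map which multiplies by `e^{i(p-q)s}` when its argument is rotated by `s` does not see
the components of type other than `(p,q)`. -/
lemma map_typePart {V : Type*} [AddCommGroup V] [Module ℂ V] (Λ : Alt k →ₗ[ℂ] V) {p q : ℕ}
    {α : Alt k} (h : ∀ s : ℝ, Λ (α.compContinuousLinearMap (rotation J s)) =
      Complex.exp (((p : ℂ) - q) * s * Complex.I) • Λ α) :
    Λ (typePart J p q α) = Λ α := by
  rw [typePart, map_smul, map_sum]
  have : ∀ j ∈ Finset.range (k + 1),
      Λ (Complex.exp (-(((p : ℂ) - (q : ℂ)) * (Real.pi * j / (k + 1)) * Complex.I)) •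
        α.compContinuousLinearMap (rotation J (Real.pi * j / (k + 1)))) = Λ α := by
    intro j _
    rw [map_smul, h, smul_smul, ← Complex.exp_add]
    push_cast
    rw [neg_add_cancel, Complex.exp_zero, one_smul]
  rw [Finset.sum_congr rfl this, Finset.sum_const, Finset.card_range, ← Nat.cast_smul_eq_nsmul ℂ,
    smul_smul]
  push_cast
  rw [inv_mul_cancel₀ (by exact_mod_cast Nat.succ_ne_zero k), one_smul]

/-- A linear map of weight `1` under the rotations annihilates the forms of type `(1,2)`. -/
lemma map_typePart_one_two_eq_zero {V : Type*} [AddCommGroup V] [Module ℂ V] (Λ : Alt 3 →ₗ[ℂ] V)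
    {α : Alt 3} (h : ∀ s : ℝ, Λ (α.compContinuousLinearMap (rotation J s)) =
      Complex.exp (s * Complex.I) • Λ α) :
    Λ (typePart J 1 2 α) = 0 := by
  rw [typePart, map_smul, map_sum]
  have : ∀ j ∈ Finset.range (3 + 1),
      Λ (Complex.exp (-(((1 : ℕ) - (2 : ℕ)) * (Real.pi * j / ((3 : ℕ) + 1)) * Complex.I)) •
        α.compContinuousLinearMap (rotation J (Real.pi * j / ((3 : ℕ) + 1)))) =
        (Complex.I) ^ j • Λ α := by
    intro j _
    rw [map_smul, h, smul_smul, ← Complex.exp_add]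
    congr 1
    conv_rhs => rw [← Complex.exp_pi_div_two_mul_I, ← Complex.exp_nat_mul]
    congr 1
    push_cast
    ring
  rw [Finset.sum_congr rfl this, ← Finset.sum_smul]
  simp [Finset.sum_range_succ, pow_succ]

/-- Forms of top degree are multiplied by the determinant under pullback. -/
lemma top_comp (β : Alt 6) (L : E →L[ℝ] E) :
    β.compContinuousLinearMap L = ((LinearMap.det (L : E →ₗ[ℝ] E) : ℝ) : ℂ) • β := by
  have hr : Module.finrank ℝ E = 6 := by
    rw [← Module.finrank_mul_finrank ℝ ℂ E]; simp [Complex.finrank_real_complex]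
  let b : Module.Basis (Fin 6) ℝ E := Module.finBasisOfFinrankEq ℝ E hr
  have key : ∀ (f : E [⋀^Fin 6]→ₗ[ℝ] ℝ) (v : Fin 6 → E),
      f (fun i => L (v i)) = LinearMap.det (L : E →ₗ[ℝ] E) * f v := by
    intro f v
    rw [f.eq_smul_basis_det b]
    simp only [AlternatingMap.smul_apply, smul_eq_mul]
    have := b.det_comp (L : E →ₗ[ℝ] E) v
    have e : b.det (fun i => L (v i)) = b.det ((L : E →ₗ[ℝ] E) ∘ v) := rfl
    rw [e, this]; ring
  ext v
  apply Complex.ext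
  · simpa [Function.comp_def] using key (Complex.reLm.compAlternatingMap β.toAlternatingMap) v
  · simpa [Function.comp_def] using key (Complex.imLm.compAlternatingMap β.toAlternatingMap) v

lemma det_rotation {Φ : E →L[ℝ] E} (hΦ : Function.Injective Φ)
    (h : ∀ v, Φ (J v) = Complex.I • Φ v) (s : ℝ) :
    LinearMap.det (rotation J s : E →ₗ[ℝ] E) = 1 := by
  have hdet : LinearMap.det (Φ : E →ₗ[ℝ] E) ≠ 0 := by
    rw [← isUnit_iff_ne_zero, ← LinearMap.isUnit_iff_isUnit_det, LinearMap.isUnit_iff_ker_eq_bot]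
    exact LinearMap.ker_eq_bot.2 hΦ
  let M : E →ₗ[ℂ] E := Complex.exp (s * Complex.I) • LinearMap.id
  have e : (Φ : E →ₗ[ℝ] E) ∘ₗ (rotation J s : E →ₗ[ℝ] E) =
      (M.restrictScalars ℝ) ∘ₗ (Φ : E →ₗ[ℝ] E) := by
    ext v i
    simp [M, rotation, h, Complex.exp_mul_I]
    ring
  have := congrArg LinearMap.det e
  rw [LinearMap.det_comp, LinearMap.det_comp, mul_comm, LinearMap.det_restrictScalars] at this
  have h2 := mul_right_cancel₀ hdet this
  rw [h2]
  simp [M, Algebra.norm_complex_eq, Complex.normSq_eq_norm_sq,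
    Complex.norm_exp_ofReal_mul_I]

end TypePart

/-! ### Invariant forms and Stokes' theorem on the quotient -/

section Stokes

open MeasureTheory Set

/-- The diagonal endomorphism of `ℂ³` with complex entries `d`. -/
def diagCLM (d : Fin 3 → ℂ) : E →L[ℝ] E :=
  ContinuousLinearMap.pi fun i => d i • (ContinuousLinearMap.proj i : E →L[ℝ] ℂ)

@[simp] lemma diagCLM_apply (d : Fin 3 → ℂ) (v : E) (i : Fin 3) : diagCLM d v i = d i * v i := rfl

lemma det_diagCLM (d : Fin 3 → ℂ) :
    LinearMap.det (diagCLM d : E →ₗ[ℝ] E) = ‖∏ i, d i‖ ^ 2 := by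
  have e : (diagCLM d : E →ₗ[ℝ] E) = (Matrix.toLin' (Matrix.diagonal d)).restrictScalars ℝ := by
    ext v i
    simp [Matrix.toLin'_apply, Matrix.mulVec_diagonal]
  rw [e, LinearMap.det_restrictScalars, LinearMap.det_toLin', Matrix.det_diagonal,
    Algebra.norm_complex_eq, ← Complex.normSq_eq_norm_sq]
  rfl

lemma contDiff_diagCLM {d : E → Fin 3 → ℂ} (hd : ∀ i, ContDiff ℝ ∞ fun z => d z i) :
    ContDiff ℝ ∞ fun z => diagCLM (d z) := by
  rw [contDiff_clm_apply_iff]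
  intro v
  rw [contDiff_pi]
  exact fun i => (hd i).mul contDiff_const

/-- The differential of the left translation by `a`, which is the same at all points. -/
def leftLin (a : E) : E →L[ℝ] E := diagCLM ![1, Complex.exp (-(a 0)), Complex.exp (a 0)]

lemma contDiff_leftLin : ContDiff ℝ ∞ leftLin := by
  refine contDiff_diagCLM fun i => ?_
  fin_cases i <;> simp <;> fun_prop

lemma det_leftLin (a : E) : LinearMap.det (leftLin a : E →ₗ[ℝ] E) = 1 := by
  rw [leftLin, det_diagCLM, Fin.prod_univ_three]
  simp [← Complex.exp_add]

lemma leftMul_eq (a z : E) : leftMul a z = a + leftLin a z := by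
  funext i
  fin_cases i <;> simp [leftMul, leftLin] <;> ring

lemma hasFDerivAt_leftMul (a z : E) : HasFDerivAt (leftMul a) (leftLin a) z := by
  have e : leftMul a = fun z => a + leftLin a z := funext (leftMul_eq a)
  rw [e]
  exact (leftLin a).hasFDerivAt.const_add a

lemma contDiff_leftMul (a : E) : ContDiff ℝ ∞ (leftMul a) := by
  have e : leftMul a = fun z => a + leftLin a z := funext (leftMul_eq a)
  rw [e]; fun_prop

lemma dLeft_eq (a z : E) : dLeft a z = leftLin a := (hasFDerivAt_leftMul a z).fderiv

lemma leftLin_leftMul (a z : E) : leftLin (leftMul a z) = (leftLin a).comp (leftLin z) := by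
  ext v i
  fin_cases i <;> simp [leftLin, leftMul, Complex.exp_add] <;> ring

/-- A form is invariant under the left translations by elements of `Γ`. -/
def IsInvForm (Γ : Subgroup G) {k : ℕ} (α : Form k) : Prop :=
  ∀ a ∈ Γ, ∀ z, (α (leftMul a z)).compContinuousLinearMap (leftLin a) = α z

lemma IsInvForm.extDeriv {Γ : Subgroup G} {k : ℕ} {α : Form k} (h : IsInvForm Γ α)
    (hα : ContDiff ℝ ∞ α) : IsInvForm Γ (extDeriv α) := by
  intro a ha z
  have h1 := extDeriv_pullback (f := leftMul a) (x := z) (hα.differentiable (by simp) _)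
    (contDiff_leftMul a).contDiffAt (by simpa using two_le_infty)
  simp only [(hasFDerivAt_leftMul a _).fderiv] at h1
  rw [← h1]
  exact congrArg (fun f => _root_.extDeriv f z) (funext fun y => h a ha y)

/-- A continuous function on the compact quotient attains its maximum. -/
lemma exists_forall_le_of_invariant {Γ : Subgroup G} [CompactSpace (Solvmanifold Γ)] {f : E → ℝ}
    (hf : Continuous f) (hinv : ∀ a ∈ Γ, ∀ z, f (leftMul a z) = f z) : ∃ z₀, ∀ z, f z ≤ f z₀ := by
  let F : Solvmanifold Γ → ℝ := Quotient.lift (s := MulAction.orbitRel Γ G) f (by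
    rintro x y ⟨γ, rfl⟩
    exact hinv γ γ.2 y)
  have hF : Continuous F := Continuous.quotient_lift hf _
  have : Nonempty (Solvmanifold Γ) := ⟨Quotient.mk (MulAction.orbitRel Γ G) (1 : G)⟩
  obtain ⟨q, -, hq⟩ := isCompact_univ.exists_isMaxOn univ_nonempty hF.continuousOn
  induction q using Quotient.inductionOn with
  | h z₀ => exact ⟨z₀, fun z => hq (mem_univ (Quotient.mk (MulAction.orbitRel Γ G) z))⟩

lemma integral_fderiv_apply_eq_zero {f : E → ℂ} (hf : ContDiff ℝ 1 f) (hc : HasCompactSupport f)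
    (v : E) : ∫ z, fderiv ℝ f z v = 0 := by
  have h := integral_mul_fderiv_eq_neg_fderiv_mul_of_integrable (μ := volume)
    (f := fun _ => (1 : ℂ)) (g := f) (v := v) (by simp) ?_ ?_ (by fun_prop)
    (fun z _ => hf.differentiable (by simp) z)
  · simpa using h
  · simpa using ((hf.continuous_fderiv (by simp)).clm_apply
      continuous_const).integrable_of_hasCompactSupport (hc.fderiv_apply (𝕜 := ℝ) v)
  · simpa using hf.continuous.integrable_of_hasCompactSupport hc

/-- Stokes' theorem for compactly supported forms of degree five on `ℂ³`. -/
lemma integral_extDeriv_eq_zero {η : Form 5} (hη : ContDiff ℝ ∞ η) (hc : HasCompactSupport η)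
    (e : Fin 6 → E) : ∫ z, extDeriv η z e = 0 := by
  have h1 : ∀ v : Fin 5 → E, ContDiff ℝ ∞ fun z => η z v := fun v =>
    (ContinuousAlternatingMap.apply ℝ E ℂ v).contDiff.comp hη
  have h2 : ∀ v : Fin 5 → E, HasCompactSupport fun z => η z v := fun v =>
    hc.comp_left (g := fun α : Alt 5 => α v) rfl
  have h3 : ∀ (v : Fin 5 → E) (w : E), Integrable fun z => fderiv ℝ (fun y => η y v) z w := by
    intro v w
    refine Continuous.integrable_of_hasCompactSupport ?_ ?_
    · exact ((h1 v).continuous_fderiv (by simp)).clm_apply continuous_const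
    · exact (h2 v).fderiv_apply (𝕜 := ℝ) w
  simp_rw [fun z => extDeriv_apply (hη.differentiable (by simp) z) e]
  rw [integral_finsetSum _ fun i _ => (h3 _ _).fun_smul _]
  refine Finset.sum_eq_zero fun i _ => ?_
  simp_rw [zsmul_eq_mul]
  rw [integral_const_mul, integral_fderiv_apply_eq_zero ((h1 _).of_le (by simp)) (h2 _), mul_zero]

lemma integral_comp_diagCLM {d : Fin 3 → ℂ} (hd : ∀ i, d i ≠ 0) :
    ∃ c : ℝ, 0 < c ∧ ∀ f : E → ℝ, Continuous f → ∫ z, f (diagCLM d z) = c * ∫ z, f z := by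
  have hdet : LinearMap.det (diagCLM d : E →ₗ[ℝ] E) ≠ 0 := by
    rw [det_diagCLM]
    have : ∏ i, d i ≠ 0 := Finset.prod_ne_zero_iff.2 fun i _ => hd i
    positivity
  refine ⟨|(LinearMap.det (diagCLM d : E →ₗ[ℝ] E))⁻¹|, by positivity, fun f hf => ?_⟩
  have h := Measure.map_linearMap_addHaar_eq_smul_addHaar (volume : Measure E) hdet
  have h2 := integral_map (μ := (volume : Measure E)) (φ := diagCLM d) (f := f)
    (diagCLM d).continuous.aemeasurable hf.aestronglyMeasurable
  rw [← h2]
  erw [h]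
  rw [integral_smul_measure, ENNReal.toReal_ofReal (abs_nonneg _), smul_eq_mul]

/-- The group `G` is amenable: there are cutoff functions whose derivatives along left-invariant
vector fields are arbitrarily small in `L¹`, relative to their integral. A bump function is
stretched by `R` in the direction of `z₁` and by `R e^{2R}`, which beats the growth of the
left-invariant vector fields on the support, in the directions of `z₂` and `z₃`. -/
lemma exists_cutoff {δ : ℝ} (hδ : 0 < δ) : ∃ χ : E → ℝ, ContDiff ℝ ∞ χ ∧ HasCompactSupport χ ∧
    (∀ z, 0 ≤ χ z) ∧ 0 < ∫ z, χ z ∧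
    ∫ z, ‖(fderiv ℝ χ z).comp (leftLin z)‖ ≤ δ * ∫ z, χ z := by
  let ρ : ContDiffBump (0 : E) := ⟨1, 2, one_pos, one_lt_two⟩
  have hρ : ContDiff ℝ ∞ ρ := ρ.contDiff
  have hρ0 : 0 < ∫ z, ρ z := ρ.integral_pos
  set A := ∫ z, ‖fderiv ℝ ρ z‖ with hA
  have hA0 : 0 ≤ A := integral_nonneg fun _ => norm_nonneg _
  obtain ⟨R, hR0, hR⟩ : ∃ R : ℝ, 0 < R ∧ R⁻¹ * A ≤ δ * ∫ z, ρ z := by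
    refine ⟨(A + 1) / (δ * ∫ z, ρ z), by positivity, ?_⟩
    rw [inv_div, div_mul_eq_mul_div, div_le_iff₀ (by positivity)]
    have : 0 < δ * ∫ z, ρ z := by positivity
    nlinarith
  let S := R * Real.exp (2 * R)
  have hS : 0 < S := by positivity
  let d : Fin 3 → ℂ := ![((R⁻¹ : ℝ) : ℂ), ((S⁻¹ : ℝ) : ℂ), ((S⁻¹ : ℝ) : ℂ)]
  have hd : ∀ i, d i ≠ 0 := by
    intro i; fin_cases i <;> simp [d, hR0.ne', hS.ne']
  obtain ⟨c, hc, hint⟩ := integral_comp_diagCLM hd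
  have hfd : ∀ z, fderiv ℝ (fun z => ρ (diagCLM d z)) z =
      (fderiv ℝ ρ (diagCLM d z)).comp (diagCLM d) := fun z =>
    ((hρ.differentiable (by simp) _).hasFDerivAt.comp z (diagCLM d).hasFDerivAt).fderiv
  have hχ : ContDiff ℝ ∞ fun z => ρ (diagCLM d z) := hρ.comp (diagCLM d).contDiff
  have hinj : Topology.IsClosedEmbedding (diagCLM d) :=
    LinearMap.isClosedEmbedding_of_injective (f := (diagCLM d : E →ₗ[ℝ] E))
      (LinearMap.ker_eq_bot.2 fun v w h => funext fun i =>
        mul_left_cancel₀ (hd i) (congrFun h i))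
  have hcs : HasCompactSupport fun z => ρ (diagCLM d z) :=
    ρ.hasCompactSupport.comp_isClosedEmbedding hinj
  refine ⟨fun z => ρ (diagCLM d z), hχ, hcs, fun z => ρ.nonneg, ?_, ?_⟩
  · rw [hint _ ρ.continuous]; positivity
  · have hb : ∀ z, ‖(fderiv ℝ (fun z => ρ (diagCLM d z)) z).comp (leftLin z)‖ ≤
        R⁻¹ * ‖fderiv ℝ ρ (diagCLM d z)‖ := by
      intro z
      rw [hfd, ContinuousLinearMap.comp_assoc]
      by_cases hz : fderiv ℝ ρ (diagCLM d z) = 0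
      · simp [hz]
      have hmem : diagCLM d z ∈ Metric.closedBall (0 : E) 2 := by
        have : diagCLM d z ∈ tsupport ρ :=
          support_fderiv_subset ℝ (Function.mem_support.2 hz)
        rwa [ρ.tsupport_eq] at this
      have hz0 : |(z 0).re| ≤ 2 * R := by
        rw [mem_closedBall_zero_iff] at hmem
        have h0 := (norm_le_pi_norm (diagCLM d z) 0).trans hmem
        simp [d, abs_of_pos hR0] at h0
        rw [inv_mul_le_iff₀ hR0] at h0
        linarith [Complex.abs_re_le_norm (z 0)]
      rw [mul_comm]
      refine (ContinuousLinearMap.opNorm_comp_le _ _).trans ?_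
      gcongr
      refine ContinuousLinearMap.opNorm_le_bound _ (by positivity) fun v => ?_
      rw [pi_norm_le_iff_of_nonneg (by positivity)]
      intro i
      have hv := norm_le_pi_norm v i
      have hexp : ∀ x : ℝ, |x| ≤ 2 * R → S⁻¹ * Real.exp x ≤ R⁻¹ := by
        intro x hx
        rw [mul_inv, mul_assoc, ← Real.exp_neg, ← Real.exp_add]
        refine mul_le_of_le_one_right (by positivity) (Real.exp_le_one_iff.2 ?_)
        linarith [le_abs_self x]
      have h1 := hexp _ hz0
      have h2 := hexp (-(z 0).re) (by rwa [abs_neg])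
      fin_cases i
      · simp [leftLin, d, abs_of_pos hR0] at hv ⊢
        gcongr
      · simp [leftLin, d, abs_of_pos hS, Complex.norm_exp] at hv ⊢
        rw [← mul_assoc]
        gcongr
      · simp [leftLin, d, abs_of_pos hS, Complex.norm_exp] at hv ⊢
        rw [← mul_assoc]
        gcongr
    have hcont : Continuous fun z => (fderiv ℝ (fun z => ρ (diagCLM d z)) z).comp (leftLin z) :=
      (hχ.continuous_fderiv (by simp)).clm_comp contDiff_leftLin.continuous
    have hρf : Continuous fun z => ‖fderiv ℝ ρ z‖ := (hρ.continuous_fderiv (by simp)).norm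
    calc ∫ z, ‖(fderiv ℝ (fun z => ρ (diagCLM d z)) z).comp (leftLin z)‖
        ≤ ∫ z, R⁻¹ * ‖fderiv ℝ ρ (diagCLM d z)‖ := by
          refine integral_mono ?_ ?_ hb
          · refine (hcont.integrable_of_hasCompactSupport ?_).norm
            exact (hcs.fderiv ℝ).mono fun z hz h0 => hz (by simp [h0])
          · refine Integrable.const_mul ?_ _
            refine (hρf.comp (diagCLM d).continuous).integrable_of_hasCompactSupport ?_
            exact ((ρ.hasCompactSupport.fderiv ℝ).norm).comp_isClosedEmbedding hinj
      _ = c * (R⁻¹ * A) := by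
          rw [integral_const_mul, hint _ hρf]; ring
      _ ≤ c * (δ * ∫ z, ρ z) := by gcongr
      _ = δ * ∫ z, ρ (diagCLM d z) := by rw [hint _ ρ.continuous]; ring

/-- On the compact quotient `Γ \ G`, an exact form of top degree is not positive. If `dτ ≥ c > 0`
and `χ` is a cutoff function, then `0 = ∫ d(χτ) ≥ c ∫ χ - M ∫ |dχ|`, where `dχ` is measured in the
left-invariant frame and `M` bounds the coefficients of `τ`. -/
lemma extDeriv_not_pos {Γ : Subgroup G} [CompactSpace (Solvmanifold Γ)] {τ : Form 5}
    (hτ : ContDiff ℝ ∞ τ) (hinv : IsInvForm Γ τ) (e : Fin 6 → E) {r : E → ℝ}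
    (hr : ∀ z, extDeriv τ z e = r z) : ¬ ∀ z, 0 < r z := by
  intro hpos
  have hre : r = fun z => (extDeriv τ z e).re := funext fun z => by rw [hr, Complex.ofReal_re]
  have hrc : Continuous r := by
    rw [hre]
    exact Complex.continuous_re.comp
      ((ContinuousAlternatingMap.apply ℝ E ℂ e).continuous.comp (contDiff_extDeriv hτ).continuous)
  have hrinv : ∀ a ∈ Γ, ∀ z, r (leftMul a z) = r z := by
    intro a ha z
    have h := hinv.extDeriv hτ a ha z
    rw [top_comp, det_leftLin a, Complex.ofReal_one, one_smul] at h
    rw [hre]; simp only [h]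
  obtain ⟨z₀, hz₀⟩ := exists_forall_le_of_invariant (Γ := Γ) hrc.neg fun a ha z => by
    exact congrArg Neg.neg (hrinv a ha z)
  -- the coefficients of `τ` in the left-invariant frame are bounded
  obtain ⟨z₁, hz₁⟩ := exists_forall_le_of_invariant (Γ := Γ)
    (f := fun z => ‖(τ z).compContinuousLinearMap (leftLin z)‖)
    (contDiff_compForm hτ contDiff_leftLin).continuous.norm fun a ha z => by
      rw [← hinv a ha z, leftLin_leftMul a]; rfl
  set c := r z₀ with hc
  set B := ‖(τ z₁).compContinuousLinearMap (leftLin z₁)‖ with hB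
  set M := 6 * B * ∏ i, ‖e i‖ with hM
  have hB0 : 0 ≤ B := norm_nonneg _
  have hM0 : 0 ≤ M := by positivity
  have hc0 : 0 < c := hpos z₀
  obtain ⟨χ, hχ, hχc, hχ0, hχi, hχδ⟩ := exists_cutoff (δ := c / (M + 1)) (by positivity)
  have hχC : ContDiff ℝ ∞ fun z => (χ z : ℂ) := Complex.ofRealCLM.contDiff.comp hχ
  have hη : ContDiff ℝ ∞ fun z => (χ z : ℂ) • τ z := hχC.smul hτ
  have hηc : HasCompactSupport fun z => (χ z : ℂ) • τ z :=
    hχc.mono fun z hz h0 => hz (by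
      change (χ z : ℂ) • τ z = 0
      rw [h0, Complex.ofReal_zero]
      exact zero_smul ℂ (τ z))
  have hfd : ∀ z, fderiv ℝ (fun z => (χ z : ℂ)) z = Complex.ofRealCLM.comp (fderiv ℝ χ z) :=
    fun z => (Complex.ofRealCLM.hasFDerivAt.comp z
      (hχ.differentiable (by simp) z).hasFDerivAt).fderiv
  have hlow : ∀ z, c * χ z - M * ‖(fderiv ℝ χ z).comp (leftLin z)‖ ≤
      (extDeriv (fun z => (χ z : ℂ) • τ z) z e).re := by
    intro z
    rw [extDeriv_smul_form (hχC.differentiable (by simp) z) (hτ.differentiable (by simp) z), hfd]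
    have h1 : ‖covWedge (Complex.ofRealCLM.comp (fderiv ℝ χ z)) (τ z) e‖ ≤
        M * ‖(fderiv ℝ χ z).comp (leftLin z)‖ := by
      have h2 := top_comp (covWedge (Complex.ofRealCLM.comp (fderiv ℝ χ z)) (τ z)) (leftLin z)
      rw [det_leftLin, Complex.ofReal_one, one_smul, covWedge_comp] at h2
      rw [← h2]
      refine (ContinuousAlternatingMap.le_opNorm _ _).trans ?_
      have h3 : ‖(Complex.ofRealCLM.comp (fderiv ℝ χ z)).comp (leftLin z)‖ ≤
          ‖(fderiv ℝ χ z).comp (leftLin z)‖ := by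
        rw [ContinuousLinearMap.comp_assoc]
        refine ContinuousLinearMap.opNorm_le_bound _ (norm_nonneg _) fun v => ?_
        simpa using ((fderiv ℝ χ z).comp (leftLin z)).le_opNorm v
      have h4 := norm_covWedge_le ((Complex.ofRealCLM.comp (fderiv ℝ χ z)).comp (leftLin z))
        ((τ z).compContinuousLinearMap (leftLin z))
      have h5 := hz₁ z
      calc _ ≤ ((5 + 1) * (‖(fderiv ℝ χ z).comp (leftLin z)‖ * B)) * ∏ i, ‖e i‖ := by
            gcongr
            refine h4.trans ?_
            push_cast
            gcongr
        _ = _ := by rw [hM]; ring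
    have h6 := (Complex.abs_re_le_norm _).trans h1
    have h7 := neg_abs_le (covWedge (Complex.ofRealCLM.comp (fderiv ℝ χ z)) (τ z) e).re
    have h8 : c * χ z ≤ r z * χ z := mul_le_mul_of_nonneg_right (neg_le_neg_iff.1 (hz₀ z)) (hχ0 z)
    simp only [ContinuousAlternatingMap.add_apply, ContinuousAlternatingMap.smul_apply, hr,
      Complex.add_re, smul_eq_mul, ← Complex.ofReal_mul, Complex.ofReal_re]
    linarith
  have hi1 : Integrable χ := hχ.continuous.integrable_of_hasCompactSupport hχc
  have hi2 : Integrable fun z => ‖(fderiv ℝ χ z).comp (leftLin z)‖ := by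
    refine (Continuous.integrable_of_hasCompactSupport ?_ ?_).norm
    · exact (hχ.continuous_fderiv (by simp)).clm_comp contDiff_leftLin.continuous
    · exact (hχc.fderiv ℝ).mono fun z hz h0 => hz (by simp [h0])
  have hi3 : Integrable fun z => extDeriv (fun z => (χ z : ℂ) • τ z) z e := by
    refine Continuous.integrable_of_hasCompactSupport ?_ ?_
    · exact (ContinuousAlternatingMap.apply ℝ E ℂ e).continuous.comp
        (contDiff_extDeriv hη).continuous
    · refine (hηc.fderiv ℝ).mono fun z hz h0 => hz ?_
      simp [extDeriv, h0, ContinuousAlternatingMap.alternatizeUncurryFin_apply]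
  have hmono := integral_mono ((hi1.const_mul c).sub (hi2.const_mul M)) hi3.re hlow
  have h0 : ∫ z, (extDeriv (fun z => (χ z : ℂ) • τ z) z e).re = 0 := by
    have := integral_re hi3
    rw [integral_extDeriv_eq_zero hη hηc e] at this
    simpa using this
  erw [h0, integral_sub (hi1.const_mul c) (hi2.const_mul M)] at hmono
  rw [integral_const_mul, integral_const_mul] at hmono
  have h9 : M * ∫ z, ‖(fderiv ℝ χ z).comp (leftLin z)‖ ≤ M * (c / (M + 1) * ∫ z, χ z) := by gcongr
  have h10 : M * (c / (M + 1) * ∫ z, χ z) < c * ∫ z, χ z := by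
    rw [← mul_assoc]
    refine mul_lt_mul_of_pos_right ?_ hχi
    rw [mul_div_assoc', div_lt_iff₀ (by positivity)]
    nlinarith
  linarith

/-- On the compact quotient `Γ \ G`, an exact real form of top degree vanishes somewhere. -/
lemma exists_extDeriv_eq_zero {Γ : Subgroup G} [CompactSpace (Solvmanifold Γ)] {τ : Form 5}
    (hτ : ContDiff ℝ ∞ τ) (hinv : IsInvForm Γ τ) (e : Fin 6 → E) {r : E → ℝ}
    (hr : ∀ z, extDeriv τ z e = r z) : ∃ z, r z = 0 := by
  by_contra! hne
  have hre : r = fun z => (extDeriv τ z e).re := funext fun z => by rw [hr, Complex.ofReal_re]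
  have hrc : Continuous r := by
    rw [hre]
    exact Complex.continuous_re.comp
      ((ContinuousAlternatingMap.apply ℝ E ℂ e).continuous.comp (contDiff_extDeriv hτ).continuous)
  obtain ⟨x, hx⟩ := not_forall.1 (extDeriv_not_pos hτ hinv e hr)
  have hneg : ∀ z, extDeriv ((-1 : ℝ) • τ) z e = ((-r z : ℝ) : ℂ) := by
    intro z
    rw [extDeriv_smul]
    simp [hr]
  have hinv' : IsInvForm Γ ((-1 : ℝ) • τ) := by
    intro a ha z
    have := congrArg (fun β : Alt 5 => (-1 : ℝ) • β) (hinv a ha z)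
    exact this
  obtain ⟨y, hy⟩ := not_forall.1 (extDeriv_not_pos (contDiff_const.smul hτ) hinv' e hneg)
  obtain ⟨z, hz⟩ := mem_range_of_exists_le_of_exists_ge hrc ⟨x, not_lt.1 hx⟩
    ⟨y, by linarith [not_lt.1 hy]⟩
  exact hne z hz

end Stokes

/-! ### Weighted frames -/

section Pair

variable {k : ℕ}

/-- The product `θ ∧ θ̄ ∧ α`. -/
def pairWedge (θ : E →L[ℝ] ℂ) (α : Alt k) : Alt (k + 2) := covWedge θ (covWedge (conjCov θ) α)

lemma contDiff_pairWedge {θ : E → E →L[ℝ] ℂ} {α : Form k} (hθ : ContDiff ℝ ∞ θ)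
    (hα : ContDiff ℝ ∞ α) : ContDiff ℝ ∞ fun z => pairWedge (θ z) (α z) :=
  contDiff_covWedge hθ (contDiff_covWedge (contDiff_conjCov hθ) hα)

lemma pairWedge_smul (θ : E →L[ℝ] ℂ) (c : ℂ) (α : Alt k) :
    pairWedge θ (c • α) = c • pairWedge θ α := by
  simp [pairWedge, covWedge_smul]

@[simp] lemma pairWedge_zero (θ : E →L[ℝ] ℂ) : pairWedge θ (0 : Alt k) = 0 := by simp [pairWedge]

lemma covWedge_pairWedge (η θ : E →L[ℝ] ℂ) (α : Alt k) :
    covWedge η (pairWedge θ α) = pairWedge θ (covWedge η α) := by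
  rw [pairWedge, covWedge_anticomm η θ, covWedge_anticomm η, covWedge_neg, neg_neg]; rfl

@[simp] lemma covWedge_pairWedge_self (θ : E →L[ℝ] ℂ) (α : Alt k) :
    covWedge θ (pairWedge θ α) = 0 := covWedge_self _ _

@[simp] lemma conjCov_covWedge_pairWedge_self (θ : E →L[ℝ] ℂ) (α : Alt k) :
    covWedge (conjCov θ) (pairWedge θ α) = 0 := covWedge_covWedge_self _ _ _

@[simp] lemma pairWedge_self (θ : E →L[ℝ] ℂ) (α : Alt k) : pairWedge θ (pairWedge θ α) = 0 := by
  rw [pairWedge, conjCov_covWedge_pairWedge_self, covWedge_zero]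

lemma pairWedge_comp (θ : E →L[ℝ] ℂ) (α : Alt k) (L : E →L[ℝ] E) :
    (pairWedge θ α).compContinuousLinearMap L =
      pairWedge (θ.comp L) (α.compContinuousLinearMap L) := by
  rw [pairWedge, covWedge_comp, covWedge_comp]; rfl

lemma pairWedge_comp_rotation {θ : E →L[ℝ] ℂ} {J : E →L[ℝ] E}
    (h : ∀ v, θ (J v) = Complex.I * θ v) (s : ℝ) (α : Alt k) :
    (pairWedge θ α).compContinuousLinearMap (rotation J s) =
      pairWedge θ (α.compContinuousLinearMap (rotation J s)) := by
  rw [pairWedge, covWedge_comp, covWedge_comp, comp_rotation h, conjCov_comp_rotation h,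
    smul_covWedge, smul_covWedge, covWedge_smul, smul_smul, ← Complex.exp_add, add_neg_cancel,
    Complex.exp_zero, one_smul]; rfl

/-- Evaluation of `θ ∧ θ̄ ∧ α` on a frame whose first two vectors are dual to the real and imaginary
parts of `θ`. -/
lemma pairWedge_apply {θ : E →L[ℝ] ℂ} (α : Alt k) {x y : E} {v : Fin k → E} (hx : θ x = 1)
    (hy : θ y = Complex.I) (hv : ∀ i, θ (v i) = 0) :
    pairWedge θ α (Matrix.vecCons x (Matrix.vecCons y v)) = -2 * Complex.I * α v := by
  have h1 : ∀ u : E, covWedge (conjCov θ) α (Matrix.vecCons u v) =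
      starRingEnd ℂ (θ u) * α v := by
    intro u
    rw [covWedge_apply, Fin.sum_univ_succ]
    simp [hv]
  rw [pairWedge, covWedge_apply, Fin.sum_univ_succ, Fin.sum_univ_succ]
  have e0 : (0 : Fin (k + 2)).removeNth (Matrix.vecCons x (Matrix.vecCons y v)) =
      Matrix.vecCons y v := rfl
  have e1 : (Fin.succ 0 : Fin (k + 2)).removeNth (Matrix.vecCons x (Matrix.vecCons y v)) =
      (Matrix.vecCons x v : Fin (k + 1) → E) := by
    funext i
    refine Fin.cases rfl (fun i => rfl) i
  simp only [e0, e1, h1]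
  simp [hv, hx, hy]
  ring

end Pair

section Lin

variable {k : ℕ} {J : E →L[ℝ] E} {p q : ℕ}

lemma typePart_add (α β : Alt k) :
    typePart J p q (α + β) = typePart J p q α + typePart J p q β := by
  ext v
  simp [typePart, ContinuousAlternatingMap.sum_apply, mul_add, Finset.sum_add_distrib]

lemma typePart_smul (c : ℂ) (α : Alt k) : typePart J p q (c • α) = c • typePart J p q α := by
  simp only [typePart, smul_comm c, Finset.smul_sum]
  rfl

lemma contDiff_rotation {J : EndField} (hJ : ContDiff ℝ ∞ J) (s : ℝ) :
    ContDiff ℝ ∞ fun z => rotation (J z) s :=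
  contDiff_const.add (hJ.const_smul _)

lemma contDiff_typePart {J : EndField} (hJ : ContDiff ℝ ∞ J) {α : Form k} (hα : ContDiff ℝ ∞ α) :
    ContDiff ℝ ∞ fun z => typePart (J z) p q (α z) := by
  refine ContDiff.const_smul _ (ContDiff.sum fun j _ => ContDiff.const_smul _ ?_)
  exact contDiff_compForm hα (contDiff_rotation hJ _)

lemma IsInvForm.typePart {Γ : Subgroup G} {J : EndField} (hJ : IsInvariant Γ J) {α : Form k}
    (hα : IsInvForm Γ α) : IsInvForm Γ fun z => typePart (J z) p q (α z) := by
  intro a ha z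
  have h := hJ a ha z
  rw [dLeft_eq a] at h
  have hR : ∀ s, (rotation (J (leftMul a z)) s).comp (leftLin a) =
      (leftLin a).comp (rotation (J z) s) := by
    intro s
    ext1 v
    have := DFunLike.congr_fun h v
    simp only [ContinuousLinearMap.comp_apply] at this
    simp [rotation, this]
  have hR' : ∀ s, ((α (leftMul a z)).compContinuousLinearMap
      (rotation (J (leftMul a z)) s)).compContinuousLinearMap (leftLin a) =
      (α z).compContinuousLinearMap (rotation (J z) s) := by
    intro s
    rw [← hα a ha z]
    ext v
    have := fun x => DFunLike.congr_fun (hR s) x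
    simp only [ContinuousLinearMap.comp_apply] at this
    simp [Function.comp_def, this]
  ext v
  have := fun s => DFunLike.congr_fun (hR' s) v
  simp only [ContinuousAlternatingMap.compContinuousLinearMap_apply] at this
  simp [Nakamura.typePart, ContinuousAlternatingMap.sum_apply, this]

end Lin

/-- A coframe of `(1,0)`-forms `φᵢ = e^{wᵢ z₁} dζᵢ` with real weights `wᵢ`, where the `ζᵢ` are
holomorphic coordinates for the complex structure `J`. That the `ζᵢ` are
holomorphic coordinates is not a field: it follows from the conditions on the `φᵢ`. -/
structure IsWeightedFrame (J : EndField) (φ : Fin 3 → E → E →L[ℝ] ℂ) (w : Fin 3 → ℝ) : Prop where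
  smooth : ∀ i, ContDiff ℝ ∞ (φ i)
  type_one_zero : ∀ i z v, φ i z (J z v) = Complex.I * φ i z v
  eq_zero : ∀ z v, (∀ i, φ i z v = 0) → v = 0
  exact_mul : ∀ i, ∃ ζ : E → ℂ, ContDiff ℝ ∞ ζ ∧
    ∀ z, φ i z = Complex.exp (w i * z 0) • fderiv ℝ ζ z

/-- The covector `dz₁`. -/
def dz : E →L[ℝ] ℂ := ContinuousLinearMap.proj 0

namespace IsWeightedFrame

variable {J : EndField} {φ : Fin 3 → E → E →L[ℝ] ℂ} {w : Fin 3 → ℝ}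
  {k : ℕ}

lemma frame_injective (hφ : IsWeightedFrame J φ w) (z : E) :
    Function.Injective (ContinuousLinearMap.pi fun i => φ i z : E →L[ℝ] E) := by
  rw [injective_iff_map_eq_zero]
  exact fun v hv => hφ.eq_zero z v fun i => congrFun hv i

lemma frame_comp (hφ : IsWeightedFrame J φ w) (z v : E) :
    (ContinuousLinearMap.pi fun i => φ i z : E →L[ℝ] E) (J z v) =
    Complex.I • (ContinuousLinearMap.pi fun i => φ i z : E →L[ℝ] E) v :=
  funext fun i => hφ.type_one_zero i z v

/-- The structure equation `dφᵢ = wᵢ dz₁ ∧ φᵢ`, in the form of a Leibniz rule. -/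
lemma extDeriv_covWedge (hφ : IsWeightedFrame J φ w) (i : Fin 3) {β : Form k}
    (hβ : ContDiff ℝ ∞ β) (z : E) :
    extDeriv (fun y => covWedge (φ i y) (β y)) z =
      (w i : ℂ) • covWedge dz (covWedge (φ i z) (β z)) - covWedge (φ i z) (extDeriv β z) := by
  obtain ⟨ζ, hζ, h⟩ := hφ.exact_mul i
  have hF : ∀ y : E, HasFDerivAt (fun y : E => Complex.exp (w i * y 0))
      (Complex.exp (w i * y 0) • ((w i : ℂ) • dz)) y := by
    intro y
    have h0 : HasFDerivAt (fun y : E => y 0) dz y := dz.hasFDerivAt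
    exact (h0.const_mul (w i : ℂ)).cexp
  have hdζ : ContDiff ℝ ∞ (fderiv ℝ ζ) := hζ.fderiv_right (by simp)
  simp only [h, smul_covWedge]
  rw [extDeriv_smul_form (hF z).differentiableAt
    ((contDiff_covWedge hdζ hβ).differentiable (by simp) z), (hF z).fderiv,
    extDeriv_covWedge_fderiv hζ hβ, smul_covWedge, smul_covWedge, covWedge_smul, smul_neg,
    smul_comm (w i : ℂ), sub_eq_add_neg]

lemma extDeriv_covWedge_conj (hφ : IsWeightedFrame J φ w) (i : Fin 3) {β : Form k}
    (hβ : ContDiff ℝ ∞ β) (z : E) :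
    extDeriv (fun y => covWedge (conjCov (φ i y)) (β y)) z =
      (w i : ℂ) • covWedge (conjCov dz) (covWedge (conjCov (φ i z)) (β z)) -
        covWedge (conjCov (φ i z)) (extDeriv β z) := by
  obtain ⟨ζ, hζ, h⟩ := hφ.exact_mul i
  have hζ' : ContDiff ℝ ∞ fun y => starRingEnd ℂ (ζ y) :=
    (Complex.conjCLE : ℂ →L[ℝ] ℂ).contDiff.comp hζ
  have hF : ∀ y : E, HasFDerivAt (fun y : E => Complex.exp (w i * starRingEnd ℂ (y 0)))
      (Complex.exp (w i * starRingEnd ℂ (y 0)) • ((w i : ℂ) • conjCov dz)) y := by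
    intro y
    have h0 : HasFDerivAt (fun y : E => starRingEnd ℂ (y 0)) (conjCov dz) y :=
      (conjCov dz).hasFDerivAt
    exact (h0.const_mul (w i : ℂ)).cexp
  have h' : ∀ y, conjCov (φ i y) = Complex.exp (w i * starRingEnd ℂ (y 0)) •
      fderiv ℝ (fun y => starRingEnd ℂ (ζ y)) y := by
    intro y
    have e : fderiv ℝ (fun y => starRingEnd ℂ (ζ y)) y = conjCov (fderiv ℝ ζ y) :=
      ((Complex.conjCLE : ℂ →L[ℝ] ℂ).hasFDerivAt.comp y
        (hζ.differentiable (by simp) y).hasFDerivAt).fderiv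
    rw [e, h]
    ext v
    simp [← Complex.exp_conj]
  have hdζ : ContDiff ℝ ∞ (fderiv ℝ fun y => starRingEnd ℂ (ζ y)) := hζ'.fderiv_right (by simp)
  simp only [h', smul_covWedge]
  rw [extDeriv_smul_form (hF z).differentiableAt
    ((contDiff_covWedge hdζ hβ).differentiable (by simp) z), (hF z).fderiv,
    extDeriv_covWedge_fderiv hζ' hβ, smul_covWedge, smul_covWedge, covWedge_smul, smul_neg,
    smul_comm (w i : ℂ), sub_eq_add_neg]

lemma extDeriv_pairWedge (hφ : IsWeightedFrame J φ w) (i : Fin 3) {β : Form k}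
    (hβ : ContDiff ℝ ∞ β) (z : E) :
    extDeriv (fun y => pairWedge (φ i y) (β y)) z =
      (w i : ℂ) • covWedge (dz + conjCov dz) (pairWedge (φ i z) (β z)) +
        pairWedge (φ i z) (extDeriv β z) := by
  have h := hφ.extDeriv_covWedge i
    (contDiff_covWedge (contDiff_conjCov (hφ.smooth i)) hβ) z
  rw [hφ.extDeriv_covWedge_conj i hβ] at h
  refine h.trans ?_
  rw [covWedge_sub, covWedge_smul, covWedge_anticomm (φ i z) (conjCov dz), add_covWedge, smul_add,
    smul_neg]
  simp only [pairWedge]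
  abel

end IsWeightedFrame

/-! ### Obstructing indices and balanced metrics -/

/-- The conditions on the index `j` of a weighted frame under which `φⱼ ∧ φ̄ⱼ` obstructs the
existence of SKT metrics: modulo `φⱼ` and `φ̄ⱼ`, the form `dz₁` is the combination `b φ₁ + c φ̄₁`
with constant coefficients. The condition `w₁ c = 0` says that `dφ₁ = w₁ dz₁ ∧ φ₁` vanishes modulo
`φⱼ` and `φ̄ⱼ`. -/
structure IsObstructing (φ : Fin 3 → E → E →L[ℝ] ℂ) (w : Fin 3 → ℝ) (j : Fin 3) (b c : ℂ) :
    Prop where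
  ne_zero : j ≠ 0
  sq_weight : w j ^ 2 = 1
  add_ne_zero : b + starRingEnd ℂ c ≠ 0
  weight_mul : (w 0 : ℂ) * c = 0
  dz_eq : ∀ z, ∃ m n : ℂ, dz = b • φ 0 z + c • conjCov (φ 0 z) + m • φ j z + n • conjCov (φ j z)

/-- For any two members of the frame, either the weights cancel or `dz₁` is a combination of them
and of their conjugates. -/
def IsBalancing (φ : Fin 3 → E → E →L[ℝ] ℂ) (w : Fin 3 → ℝ) : Prop :=
  ∀ i j, i ≠ j → w i + w j = 0 ∨ ∀ z, ∃ a b c d : ℂ,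
    dz = a • φ i z + b • conjCov (φ i z) + c • φ j z + d • conjCov (φ j z)

lemma conjCov_add (θ η : E →L[ℝ] ℂ) : conjCov (θ + η) = conjCov θ + conjCov η := by
  ext v; simp

lemma conjCov_smul (c : ℂ) (θ : E →L[ℝ] ℂ) :
    conjCov (c • θ) = starRingEnd ℂ c • conjCov θ := by
  ext v; simp

@[simp] lemma conjCov_conjCov (θ : E →L[ℝ] ℂ) : conjCov (conjCov θ) = θ := by
  ext v; simp

section Balanced

variable {Γ : Subgroup G} {J : EndField} {φ : Fin 3 → E → E →L[ℝ] ℂ} {w : Fin 3 → ℝ}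

/-- The metric `∑ᵢ φᵢ ⊙ φ̄ᵢ` of a coframe; its fundamental form is `(i/2) ∑ᵢ φᵢ ∧ φ̄ᵢ`. -/
def IsWeightedFrame.diagonalMetric (hφ : IsWeightedFrame J φ w)
    (hinv : ∀ i, ∀ a ∈ Γ, ∀ z, (φ i (leftMul a z)).comp (dLeft a z) = φ i z) :
    HermitianMetric Γ J where
  g z := ∑ i, (innerSL ℝ (E := ℂ)).bilinearComp (φ i z) (φ i z)
  smooth := by
    rw [contDiff_clm_apply_iff]
    intro v
    rw [contDiff_clm_apply_iff]
    intro u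
    have h : ∀ i (v : E), ContDiff ℝ ∞ fun z => φ i z v := fun i v =>
      (hφ.smooth i).clm_apply contDiff_const
    simp only [_root_.sum_apply, ContinuousLinearMap.bilinearComp_apply,
      innerSL_apply_apply]
    exact ContDiff.sum fun i _ => (h i v).inner ℝ (h i u)
  symm z v u := by
    simp only [_root_.sum_apply, ContinuousLinearMap.bilinearComp_apply,
      innerSL_apply_apply]
    exact Finset.sum_congr rfl fun i _ => real_inner_comm _ _
  pos z v hv := by
    simp only [_root_.sum_apply, ContinuousLinearMap.bilinearComp_apply,
      innerSL_apply_apply]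
    obtain ⟨i, hi⟩ := not_forall.1 (mt (hφ.eq_zero z v) hv)
    exact Finset.sum_pos' (fun i _ => real_inner_self_nonneg)
      ⟨i, Finset.mem_univ i, real_inner_self_pos.2 hi⟩
  compatible z v u := by
    simp only [_root_.sum_apply, ContinuousLinearMap.bilinearComp_apply,
      innerSL_apply_apply, hφ.type_one_zero]
    refine Finset.sum_congr rfl fun i _ => ?_
    simp [Complex.inner]
  invariant a ha z v u := by
    simp only [_root_.sum_apply, ContinuousLinearMap.bilinearComp_apply,
      innerSL_apply_apply]
    refine Finset.sum_congr rfl fun i _ => ?_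
    rw [← hinv i a ha z]; rfl
  fundForm z := ∑ i, wedge (oneForm ((Complex.I / 2) • φ i z)) (oneForm (conjCov (φ i z)))
  fundForm_apply z v u := by
    simp only [_root_.sum_apply, ContinuousLinearMap.bilinearComp_apply,
      innerSL_apply_apply, hφ.type_one_zero, ContinuousAlternatingMap.sum_apply,
      wedge_oneForm_apply, Complex.ofReal_sum]
    refine Finset.sum_congr rfl fun i _ => ?_
    apply Complex.ext <;> simp [Complex.inner] <;> ring

lemma IsWeightedFrame.diagonalMetric_isDiagonal (hφ : IsWeightedFrame J φ w)
    (hinv : ∀ i, ∀ a ∈ Γ, ∀ z, (φ i (leftMul a z)).comp (dLeft a z) = φ i z) :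
    (hφ.diagonalMetric hinv).IsDiagonal φ := by
  intro z v u
  simp [diagonalMetric, Complex.inner]
  refine Finset.sum_congr rfl fun i _ => ?_
  ring

lemma wedge_sum {k l : ℕ} {ι : Type*} (s : Finset ι) (α : Alt k) (β : ι → Alt l) :
    wedge α (∑ i ∈ s, β i) = ∑ i ∈ s, wedge α (β i) :=
  map_sum (AddMonoidHom.mk' (wedge α) (wedge_add α)) β s

lemma sum_wedge {k l : ℕ} {ι : Type*} (s : Finset ι) (α : ι → Alt k) (β : Alt l) :
    wedge (∑ i ∈ s, α i) β = ∑ i ∈ s, wedge (α i) β :=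
  map_sum (AddMonoidHom.mk' (wedge · β) (fun α γ => add_wedge α γ β)) α s

@[simp] lemma extDeriv_const_form {k : ℕ} (α : Alt k) (z : E) :
    extDeriv (fun _ : E => α) z = 0 := by
  ext v; simp [extDeriv, ContinuousAlternatingMap.alternatizeUncurryFin_apply]

lemma covWedge_pairWedge_pairWedge_of_mem {k : ℕ} {η θ ξ : E →L[ℝ] ℂ} {α : Alt k} {a b c d : ℂ}
    (h : η = a • θ + b • conjCov θ + c • ξ + d • conjCov ξ) :
    covWedge (η + conjCov η) (pairWedge θ (pairWedge ξ α)) = 0 := by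
  have h0 : covWedge ξ (pairWedge θ (pairWedge ξ α)) = 0 := by
    rw [covWedge_pairWedge, covWedge_pairWedge_self, pairWedge_zero]
  have h1 : covWedge (conjCov ξ) (pairWedge θ (pairWedge ξ α)) = 0 := by
    rw [covWedge_pairWedge, conjCov_covWedge_pairWedge_self, pairWedge_zero]
  rw [h]
  simp only [conjCov_add, conjCov_smul, conjCov_conjCov, add_covWedge, smul_covWedge, h0, h1,
    covWedge_pairWedge_self, conjCov_covWedge_pairWedge_self]
  simp

/-- The products `φᵢ ∧ φ̄ᵢ ∧ φⱼ ∧ φ̄ⱼ` are closed, since their derivative is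
`(wᵢ + wⱼ) (dz₁ + dz̄₁) ∧ φᵢ ∧ φ̄ᵢ ∧ φⱼ ∧ φ̄ⱼ`. -/
lemma IsWeightedFrame.extDeriv_pairWedge_pairWedge (hφ : IsWeightedFrame J φ w)
    (hb : IsBalancing φ w) (i j : Fin 3) (z : E) :
    extDeriv (fun y => pairWedge (φ i y) (pairWedge (φ j y) altOne)) z = 0 := by
  by_cases hij : i = j
  · subst hij; simp
  rw [hφ.extDeriv_pairWedge i (contDiff_pairWedge (hφ.smooth j) contDiff_const),
    hφ.extDeriv_pairWedge j contDiff_const, extDeriv_const_form, pairWedge_zero, add_zero,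
    pairWedge_smul, ← covWedge_pairWedge]
  refine Eq.trans (add_smul (w i : ℂ) (w j : ℂ)
    (covWedge (dz + conjCov dz) (pairWedge (φ i z) (pairWedge (φ j z) altOne)))).symm ?_
  rcases hb i j hij with h | h
  · rw [← Complex.ofReal_add, h, Complex.ofReal_zero, zero_smul]
  · obtain ⟨a, b, c, d, h⟩ := h z
    rw [covWedge_pairWedge_pairWedge_of_mem h]
    exact smul_zero ((w i : ℂ) + w j)

lemma IsWeightedFrame.diagonalMetric_isBalanced (hφ : IsWeightedFrame J φ w)
    (hinv : ∀ i, ∀ a ∈ Γ, ∀ z, (φ i (leftMul a z)).comp (dLeft a z) = φ i z)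
    (hb : IsBalancing φ w) : (hφ.diagonalMetric hinv).IsBalanced := by
  intro z
  have e : (fun y => wedge ((hφ.diagonalMetric hinv).fundForm y)
      ((hφ.diagonalMetric hinv).fundForm y)) = fun y => ∑ i, ∑ j, (Complex.I / 2) ^ 2 •
        pairWedge (φ i y) (pairWedge (φ j y) altOne) := by
    funext y
    simp only [diagonalMetric, wedge_sum, sum_wedge, wedge_wedge_oneForm]
    rw [Finset.sum_comm]
    refine Finset.sum_congr rfl fun i _ => Finset.sum_congr rfl fun j _ => ?_
    simp only [smul_covWedge, covWedge_smul, smul_smul, pow_two]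
    rfl
  rw [e]
  have hd : ∀ i j, Differentiable ℝ fun y => (Complex.I / 2) ^ 2 •
      pairWedge (φ i y) (pairWedge (φ j y) altOne) := fun i j =>
    ((contDiff_pairWedge (hφ.smooth i) (contDiff_pairWedge (hφ.smooth j)
      contDiff_const)).const_smul _).differentiable (by simp)
  have hfd : fderiv ℝ (fun y => ∑ i, ∑ j, (Complex.I / 2) ^ 2 •
      pairWedge (φ i y) (pairWedge (φ j y) altOne)) z = ∑ i, ∑ j, fderiv ℝ (fun y =>
        (Complex.I / 2) ^ 2 • pairWedge (φ i y) (pairWedge (φ j y) altOne)) z := by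
    rw [fderiv_fun_sum fun i _ => (Differentiable.fun_sum fun j _ => hd i j) z]
    refine Finset.sum_congr rfl fun i _ => ?_
    rw [fderiv_fun_sum fun j _ => hd i j z]
  rw [extDeriv, hfd]
  simp only [← ContinuousAlternatingMap.alternatizeUncurryFinCLM_apply, map_sum]
  refine Finset.sum_eq_zero fun i _ => Finset.sum_eq_zero fun j _ => ?_
  change extDeriv (fun y => (Complex.I / 2) ^ 2 •
    pairWedge (φ i y) (pairWedge (φ j y) altOne)) z = 0
  rw [extDeriv_const_smul_form _ ((contDiff_pairWedge (hφ.smooth i)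
      (contDiff_pairWedge (hφ.smooth j) contDiff_const)).differentiable (by simp) z),
    hφ.extDeriv_pairWedge_pairWedge hb, smul_zero]

end Balanced

/-! ### Derivatives of multiples of the obstructing form -/

section

variable {Γ : Subgroup G} {J : EndField} {φ : Fin 3 → E → E →L[ℝ] ℂ} {w : Fin 3 → ℝ} {j : Fin 3}
  {b c : ℂ} {k : ℕ}

lemma IsObstructing.dz_pairWedge (ho : IsObstructing φ w j b c) (z : E) (α : Alt k) :
    covWedge dz (pairWedge (φ j z) α) = b • covWedge (φ 0 z) (pairWedge (φ j z) α) +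
      c • covWedge (conjCov (φ 0 z)) (pairWedge (φ j z) α) := by
  obtain ⟨m, n, h⟩ := ho.dz_eq z
  rw [h]
  simp [add_covWedge, smul_covWedge]

lemma IsObstructing.conj_dz_pairWedge (ho : IsObstructing φ w j b c) (z : E) (α : Alt k) :
    covWedge (conjCov dz) (pairWedge (φ j z) α) =
      starRingEnd ℂ c • covWedge (φ 0 z) (pairWedge (φ j z) α) +
      starRingEnd ℂ b • covWedge (conjCov (φ 0 z)) (pairWedge (φ j z) α) := by
  obtain ⟨m, n, h⟩ := ho.dz_eq z
  rw [h]
  simp [add_covWedge, smul_covWedge, conjCov_add, conjCov_smul, add_comm]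

/-- With `a = b + c̄`, the derivative of `φⱼ ∧ φ̄ⱼ ∧ β` is
`wⱼ (a φ₁ + ā φ̄₁) ∧ φⱼ ∧ φ̄ⱼ ∧ β + φⱼ ∧ φ̄ⱼ ∧ dβ`. -/
lemma IsWeightedFrame.extDeriv_obstructing (hφ : IsWeightedFrame J φ w)
    (ho : IsObstructing φ w j b c) {β : Form k} (hβ : ContDiff ℝ ∞ β) (z : E) :
    extDeriv (fun y => pairWedge (φ j y) (β y)) z =
      ((w j : ℂ) * (b + starRingEnd ℂ c)) • covWedge (φ 0 z) (pairWedge (φ j z) (β z)) +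
      ((w j : ℂ) * starRingEnd ℂ (b + starRingEnd ℂ c)) •
        covWedge (conjCov (φ 0 z)) (pairWedge (φ j z) (β z)) +
      pairWedge (φ j z) (extDeriv β z) := by
  rw [hφ.extDeriv_pairWedge j hβ, add_covWedge, ho.dz_pairWedge, ho.conj_dz_pairWedge]
  congr 1
  ext v
  simp
  ring

/-- The derivative of `φ₁ ∧ φⱼ ∧ φ̄ⱼ ∧ β`. -/
lemma IsWeightedFrame.extDeriv_zero_obstructing (hφ : IsWeightedFrame J φ w)
    (ho : IsObstructing φ w j b c) {β : Form k} (hβ : ContDiff ℝ ∞ β) (z : E) :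
    extDeriv (fun y => covWedge (φ 0 y) (pairWedge (φ j y) (β y))) z =
      -((w j : ℂ) * starRingEnd ℂ (b + starRingEnd ℂ c)) •
        pairWedge (φ 0 z) (pairWedge (φ j z) (β z)) -
      covWedge (φ 0 z) (pairWedge (φ j z) (extDeriv β z)) := by
  rw [hφ.extDeriv_covWedge 0 (contDiff_pairWedge (hφ.smooth j) hβ),
    hφ.extDeriv_obstructing ho hβ, covWedge_anticomm dz, ho.dz_pairWedge]
  simp only [covWedge_add, covWedge_smul, covWedge_self, alt_smul_zero, zero_add]
  have h0 := ho.weight_mul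
  have e : covWedge (φ 0 z) (covWedge (conjCov (φ 0 z)) (pairWedge (φ j z) (β z))) =
      pairWedge (φ 0 z) (pairWedge (φ j z) (β z)) := rfl
  rw [e]
  ext v
  simp
  linear_combination -(pairWedge (φ 0 z) (pairWedge (φ j z) (β z)) v) * h0

/-- The derivative of `φ̄₁ ∧ φⱼ ∧ φ̄ⱼ ∧ β`. -/
lemma IsWeightedFrame.extDeriv_conj_zero_obstructing (hφ : IsWeightedFrame J φ w)
    (ho : IsObstructing φ w j b c) {β : Form k} (hβ : ContDiff ℝ ∞ β) (z : E) :
    extDeriv (fun y => covWedge (conjCov (φ 0 y)) (pairWedge (φ j y) (β y))) z =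
      ((w j : ℂ) * (b + starRingEnd ℂ c)) •
        pairWedge (φ 0 z) (pairWedge (φ j z) (β z)) -
      covWedge (conjCov (φ 0 z)) (pairWedge (φ j z) (extDeriv β z)) := by
  rw [hφ.extDeriv_covWedge_conj 0 (contDiff_pairWedge (hφ.smooth j) hβ),
    hφ.extDeriv_obstructing ho hβ, covWedge_anticomm (conjCov dz), ho.conj_dz_pairWedge]
  simp only [covWedge_add, covWedge_smul, covWedge_self, alt_smul_zero, add_zero]
  have h0 := congrArg (starRingEnd ℂ) ho.weight_mul
  simp only [map_mul, Complex.conj_ofReal, map_zero] at h0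
  rw [covWedge_anticomm (conjCov (φ 0 z)) (φ 0 z)]
  have e : covWedge (φ 0 z) (covWedge (conjCov (φ 0 z)) (pairWedge (φ j z) (β z))) =
      pairWedge (φ 0 z) (pairWedge (φ j z) (β z)) := rfl
  rw [e]
  ext v
  simp
  linear_combination (pairWedge (φ 0 z) (pairWedge (φ j z) (β z)) v) * h0

lemma altOne_comp (L : E →L[ℝ] E) : altOne.compContinuousLinearMap L = altOne := rfl

lemma IsWeightedFrame.delDelbar_obstructing (hφ : IsWeightedFrame J φ w)
    (ho : IsObstructing φ w j b c) (z : E) :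
    delDelbar J (fun y => pairWedge (φ j y) altOne) z =
      ((‖b + starRingEnd ℂ c‖ ^ 2 : ℝ) : ℂ) • pairWedge (φ 0 z) (pairWedge (φ j z) altOne) := by
  set a := b + starRingEnd ℂ c with ha
  have h1 : delbar J 1 1 (fun y => pairWedge (φ j y) altOne) =
      fun y => ((w j : ℂ) * starRingEnd ℂ a) •
        covWedge (conjCov (φ 0 y)) (pairWedge (φ j y) altOne) := by
    funext y
    rw [delbar, hφ.extDeriv_obstructing ho contDiff_const, extDeriv_const_form, pairWedge_zero,
      add_zero, typePart_add, typePart_smul, typePart_smul]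
    have e1 : typePart (J y) 1 2 (covWedge (φ 0 y) (pairWedge (φ j y) altOne)) = 0 := by
      refine map_typePart_one_two_eq_zero (LinearMap.id : Alt 3 →ₗ[ℂ] Alt 3) fun s => ?_
      rw [LinearMap.id_apply, LinearMap.id_apply, covWedge_comp, pairWedge_comp_rotation
        (hφ.type_one_zero j y), comp_rotation (hφ.type_one_zero 0 y), smul_covWedge, altOne_comp]
    have e2 : typePart (J y) 1 2 (covWedge (conjCov (φ 0 y)) (pairWedge (φ j y) altOne)) =
        covWedge (conjCov (φ 0 y)) (pairWedge (φ j y) altOne) := by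
      refine map_typePart (LinearMap.id : Alt 3 →ₗ[ℂ] Alt 3) fun s => ?_
      rw [LinearMap.id_apply, LinearMap.id_apply, covWedge_comp, pairWedge_comp_rotation
        (hφ.type_one_zero j y), conjCov_comp_rotation (hφ.type_one_zero 0 y), smul_covWedge,
        altOne_comp]
      congr 2
      push_cast; ring
    have e2' := congrArg (fun β : Alt 3 => ((w j : ℂ) * starRingEnd ℂ a) • β) e2
    have e1' := congrArg (fun β : Alt 3 => ((w j : ℂ) * a) • β) e1
    refine (congrArg₂ (fun α β : Alt 3 => α + β) e1' e2').trans ?_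
    ext v
    simp
  have e3 : typePart (J z) 2 2 (pairWedge (φ 0 z) (pairWedge (φ j z) altOne)) =
      pairWedge (φ 0 z) (pairWedge (φ j z) altOne) := by
    refine map_typePart (LinearMap.id : Alt 4 →ₗ[ℂ] Alt 4) fun s => ?_
    rw [LinearMap.id_apply, LinearMap.id_apply, pairWedge_comp_rotation (hφ.type_one_zero 0 z),
      pairWedge_comp_rotation (hφ.type_one_zero j z), altOne_comp]
    simp
  have hsm : ContDiff ℝ ∞ fun y => covWedge (conjCov (φ 0 y)) (pairWedge (φ j y) altOne) :=
    contDiff_covWedge (contDiff_conjCov (hφ.smooth 0))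
      (contDiff_pairWedge (hφ.smooth j) contDiff_const)
  have h2 : extDeriv (fun y => ((w j : ℂ) * starRingEnd ℂ a) •
      covWedge (conjCov (φ 0 y)) (pairWedge (φ j y) altOne)) z =
      ((‖a‖ ^ 2 : ℝ) : ℂ) • pairWedge (φ 0 z) (pairWedge (φ j z) altOne) := by
    rw [extDeriv_const_smul_form _ (hsm.differentiable (by simp) z),
      hφ.extDeriv_conj_zero_obstructing ho contDiff_const, extDeriv_const_form, pairWedge_zero,
      covWedge_zero, sub_zero, ← ha, smul_smul]
    congr 1
    have hw : (w j : ℂ) ^ 2 = 1 := by exact_mod_cast ho.sq_weight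
    rw [show (w j : ℂ) * starRingEnd ℂ a * ((w j : ℂ) * a) =
      (w j : ℂ) ^ 2 * (starRingEnd ℂ a * a) by ring, hw, one_mul, Complex.conj_mul']
    push_cast; rfl
  rw [delDelbar, del, h1]
  refine (congrArg (typePart (J z) 2 2) h2).trans ?_
  rw [typePart_smul]
  exact congrArg (fun β : Alt 4 => ((‖a‖ ^ 2 : ℝ) : ℂ) • β) e3

end

/-! ### Nonexistence of SKT metrics -/

section

variable {Γ : Subgroup G} {J : EndField} {φ : Fin 3 → E → E →L[ℝ] ℂ} {w : Fin 3 → ℝ} {j : Fin 3}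
  {b c : ℂ} {k : ℕ}

lemma IsWeightedFrame.delDelbar_obstructing_wedge (hφ : IsWeightedFrame J φ w)
    (ho : IsObstructing φ w j b c) (z : E) :
    delDelbar J (fun y => wedge (oneForm (φ j y)) (conjForm (oneForm (φ j y)))) z =
      -((‖b + starRingEnd ℂ c‖ ^ 2 : ℝ) : ℂ) • wedge
        (wedge (oneForm (φ 0 z)) (oneForm (φ j z)))
        (conjForm (wedge (oneForm (φ 0 z)) (oneForm (φ j z)))) := by
  have e : (fun y => wedge (oneForm (φ j y)) (conjForm (oneForm (φ j y)))) =
      fun y => pairWedge (φ j y) altOne :=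
    funext fun y => wedge_oneForm (φ j y) (conjCov (φ j y))
  rw [e, hφ.delDelbar_obstructing ho, conjForm_wedge_oneForm, wedge_wedge_oneForm,
    covWedge_anticomm (φ j z) (conjCov (φ 0 z)), covWedge_neg]
  ext v
  simp [pairWedge]

/-- Pulling back by a rotation does not change forms of top degree. -/
lemma IsWeightedFrame.top_comp_rotation (hφ : IsWeightedFrame J φ w) (z : E) (s : ℝ) (β : Alt 6) :
    β.compContinuousLinearMap (rotation (J z) s) = β := by
  rw [top_comp, det_rotation (hφ.frame_injective z) (hφ.frame_comp z), Complex.ofReal_one, one_smul]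

/-- Only the part of type `(2,2)` of a `4`-form contributes to its product with `φⱼ ∧ φ̄ⱼ`. -/
lemma IsWeightedFrame.pairWedge_typePart (hφ : IsWeightedFrame J φ w) (z : E) (γ : Alt 4) :
    pairWedge (φ j z) (typePart (J z) 2 2 γ) = pairWedge (φ j z) γ := by
  refine map_typePart ((covWedgeₗ 5 (φ j z)).comp (covWedgeₗ 4 (conjCov (φ j z)))) fun s => ?_
  change pairWedge (φ j z) (γ.compContinuousLinearMap (rotation (J z) s)) =
    _ • pairWedge (φ j z) γ
  rw [← pairWedge_comp_rotation (hφ.type_one_zero j z), hφ.top_comp_rotation]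
  simp

/-- Only the part of type `(1,2)` of a `3`-form contributes to its product with
`φ₁ ∧ φⱼ ∧ φ̄ⱼ`. -/
lemma IsWeightedFrame.covWedge_pairWedge_typePart (hφ : IsWeightedFrame J φ w) (z : E)
    (γ : Alt 3) : covWedge (φ 0 z) (pairWedge (φ j z) (typePart (J z) 1 2 γ)) =
      covWedge (φ 0 z) (pairWedge (φ j z) γ) := by
  refine map_typePart ((covWedgeₗ 5 (φ 0 z)).comp
    ((covWedgeₗ 4 (φ j z)).comp (covWedgeₗ 3 (conjCov (φ j z))))) fun s => ?_
  change covWedge (φ 0 z) (pairWedge (φ j z) (γ.compContinuousLinearMap (rotation (J z) s))) =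
    _ • covWedge (φ 0 z) (pairWedge (φ j z) γ)
  have h := hφ.top_comp_rotation z s (covWedge (φ 0 z) (pairWedge (φ j z) γ))
  rw [covWedge_comp, pairWedge_comp_rotation (hφ.type_one_zero j z),
    comp_rotation (hφ.type_one_zero 0 z), smul_covWedge] at h
  rw [← h, smul_smul, ← Complex.exp_add]
  have e : ((1 : ℕ) - (2 : ℕ) : ℂ) * s * Complex.I + s * Complex.I = 0 := by push_cast; ring
  rw [e, Complex.exp_zero, one_smul]

lemma IsWeightedFrame.conj_covWedge_pairWedge_typePart (hφ : IsWeightedFrame J φ w) (z : E)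
    (γ : Alt 3) :
    covWedge (conjCov (φ 0 z)) (pairWedge (φ j z) (typePart (J z) 1 2 γ)) = 0 := by
  refine map_typePart_one_two_eq_zero ((covWedgeₗ 5 (conjCov (φ 0 z))).comp
    ((covWedgeₗ 4 (φ j z)).comp (covWedgeₗ 3 (conjCov (φ j z))))) fun s => ?_
  change covWedge (conjCov (φ 0 z))
    (pairWedge (φ j z) (γ.compContinuousLinearMap (rotation (J z) s))) =
    _ • covWedge (conjCov (φ 0 z)) (pairWedge (φ j z) γ)
  have h := hφ.top_comp_rotation z s (covWedge (conjCov (φ 0 z)) (pairWedge (φ j z) γ))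
  rw [covWedge_comp, pairWedge_comp_rotation (hφ.type_one_zero j z),
    conjCov_comp_rotation (hφ.type_one_zero 0 z), smul_covWedge] at h
  rw [← h, smul_smul, ← Complex.exp_add, add_neg_cancel, Complex.exp_zero, one_smul]

lemma HermitianMetric.contDiff_fundForm (h : HermitianMetric Γ J) (hJ : ContDiff ℝ ∞ J) :
    ContDiff ℝ ∞ h.fundForm := by
  refine contDiff_form_of_apply fun v => ?_
  have e : (fun z => h.fundForm z v) = fun z => ((h.g z (J z (v 0)) (v 1) : ℝ) : ℂ) := by
    funext z
    rw [← h.fundForm_apply]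
    congr 1
    funext i
    fin_cases i <;> rfl
  rw [e]
  exact Complex.ofRealCLM.contDiff.comp
    ((h.smooth.clm_apply (hJ.clm_apply contDiff_const)).clm_apply contDiff_const)

lemma HermitianMetric.fundForm_isInvForm (h : HermitianMetric Γ J) (hJ : IsInvariant Γ J) :
    IsInvForm Γ h.fundForm := by
  intro a ha z
  ext v
  have hv : ∀ u : Fin 2 → E, u = ![u 0, u 1] := fun u => by funext i; fin_cases i <;> rfl
  rw [ContinuousAlternatingMap.compContinuousLinearMap_apply, hv v, hv (_ ∘ _), h.fundForm_apply,
    h.fundForm_apply, ← h.invariant a ha z]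
  have h1 := DFunLike.congr_fun (hJ a ha z) (v 0)
  simp only [ContinuousLinearMap.comp_apply] at h1
  rw [← h1, dLeft_eq a z]
  rfl

lemma isInvForm_pairWedge {θ : E → E →L[ℝ] ℂ}
    (hθ : ∀ a ∈ Γ, ∀ z, (θ (leftMul a z)).comp (dLeft a z) = θ z) {α : Form k}
    (hα : IsInvForm Γ α) : IsInvForm Γ fun z => pairWedge (θ z) (α z) := by
  intro a ha z
  rw [pairWedge_comp, hα a ha z, ← dLeft_eq a z, hθ a ha z]

lemma isInvForm_covWedge {θ : E → E →L[ℝ] ℂ}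
    (hθ : ∀ a ∈ Γ, ∀ z, (θ (leftMul a z)).comp (dLeft a z) = θ z) {α : Form k}
    (hα : IsInvForm Γ α) : IsInvForm Γ fun z => covWedge (θ z) (α z) := by
  intro a ha z
  rw [covWedge_comp, hα a ha z, ← dLeft_eq a z, hθ a ha z]

/-- The product of a fundamental form with `φ₁ ∧ φ̄₁ ∧ φⱼ ∧ φ̄ⱼ` is a real volume form: it is
evaluated on the frame dual to `φ`. -/
lemma HermitianMetric.exists_volume (h : HermitianMetric Γ J)
    (hφ : IsWeightedFrame J φ w) (hj : j ≠ 0) :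
    ∃ e : Fin 6 → E, ∀ z, ∃ r : ℝ, r ≠ 0 ∧
      pairWedge (φ 0 z) (pairWedge (φ j z) (h.fundForm z)) e = r := by
  obtain ⟨l, hl0, hlj⟩ : ∃ l : Fin 3, l ≠ 0 ∧ l ≠ j := by
    fin_cases j
    · exact absurd rfl hj
    · exact ⟨2, by decide, by decide⟩
    · exact ⟨1, by decide, by decide⟩
  let u : Fin 3 → ℂ → E := fun i x => Pi.single i x
  refine ⟨![u 0 1, u 0 Complex.I, u j 1, u j Complex.I, u l 1, u l Complex.I], fun z => ?_⟩
  set Φ : E →L[ℝ] E := ContinuousLinearMap.pi fun i => φ i z with hΦ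
  have hinj : Function.Injective Φ := hφ.frame_injective z
  have hsurj : Function.Surjective Φ :=
    LinearMap.surjective_of_injective (f := (Φ : E →ₗ[ℝ] E)) hinj
  have hdet : LinearMap.det (Φ : E →ₗ[ℝ] E) ≠ 0 := by
    rw [← isUnit_iff_ne_zero, ← LinearMap.isUnit_iff_isUnit_det, LinearMap.isUnit_iff_ker_eq_bot]
    exact LinearMap.ker_eq_bot.2 hinj
  choose s hs using fun i x => hsurj (u i x)
  have hφs : ∀ i i' x, φ i z (s i' x) = u i' x i := fun i i' x => congrFun (hs i' x) i
  have hJs : J z (s l 1) = s l Complex.I := by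
    apply hinj
    refine (hφ.frame_comp z _).trans (((congrArg (Complex.I • ·) (hs l 1))).trans
      (Eq.trans ?_ (hs l Complex.I).symm))
    funext i
    by_cases hi : i = l
    · subst hi; simp [u]
    · simp [u, hi]
  have hne : s l Complex.I ≠ 0 := by
    intro h0
    have := hφs l l Complex.I
    rw [h0] at this
    simp [u, eq_comm] at this
  have hpos := h.pos z _ hne
  refine ⟨LinearMap.det (Φ : E →ₗ[ℝ] E) * (-4 * h.g z (s l Complex.I) (s l Complex.I)),
    mul_ne_zero hdet (by linarith), ?_⟩
  have htop := top_comp (pairWedge (φ 0 z) (pairWedge (φ j z) (h.fundForm z))) Φ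
  have hval : pairWedge (φ 0 z) (pairWedge (φ j z) (h.fundForm z))
      ![s 0 1, s 0 Complex.I, s j 1, s j Complex.I, s l 1, s l Complex.I] =
      ((-4 * h.g z (s l Complex.I) (s l Complex.I) : ℝ) : ℂ) := by
    have h1 := pairWedge_apply (θ := φ 0 z) (pairWedge (φ j z) (h.fundForm z)) (x := s 0 1)
      (y := s 0 Complex.I) (v := ![s j 1, s j Complex.I, s l 1, s l Complex.I])
      (by simp [hφs, u]) (by simp [hφs, u])
      (by intro i; fin_cases i <;> simp [hφs, u, hj.symm, hl0.symm])
    have h2 := pairWedge_apply (θ := φ j z) (h.fundForm z) (x := s j 1)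
      (y := s j Complex.I) (v := ![s l 1, s l Complex.I])
      (by simp [hφs, u]) (by simp [hφs, u])
      (by intro i; fin_cases i <;> simp [hφs, u, hlj.symm])
    refine h1.trans ?_
    erw [h2, h.fundForm_apply, hJs]
    push_cast
    linear_combination 4 * ((h.g z (s l Complex.I) (s l Complex.I) : ℝ) : ℂ) * Complex.I_sq
  have hb : (![u 0 1, u 0 Complex.I, u j 1, u j Complex.I, u l 1, u l Complex.I] : Fin 6 → E) =
      Φ ∘ ![s 0 1, s 0 Complex.I, s j 1, s j Complex.I, s l 1, s l Complex.I] := by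
    funext i
    fin_cases i <;> exact (hs _ _).symm
  have hcomp := DFunLike.congr_fun htop
    ![s 0 1, s 0 Complex.I, s j 1, s j Complex.I, s l 1, s l Complex.I]
  rw [ContinuousAlternatingMap.compContinuousLinearMap_apply, ← hb] at hcomp
  rw [hcomp, Complex.ofReal_mul, ← hval]
  rfl

/-- The obstruction to SKT metrics: if `∂∂̄ω = 0`, then
`d (φⱼ ∧ φ̄ⱼ ∧ ∂̄ω + wⱼ a φ₁ ∧ φⱼ ∧ φ̄ⱼ ∧ ω) = -|a|² φ₁ ∧ φ̄₁ ∧ φⱼ ∧ φ̄ⱼ ∧ ω`, and the right-hand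
side is a volume form, which cannot be exact on the compact manifold `Γ \ G`. -/
theorem IsWeightedFrame.not_isSKT [CompactSpace (Solvmanifold Γ)] (hφ : IsWeightedFrame J φ w)
    (hinv : ∀ i, ∀ a ∈ Γ, ∀ z, (φ i (leftMul a z)).comp (dLeft a z) = φ i z)
    (hJ : IsComplexStructure Γ J) (ho : IsObstructing φ w j b c) (h : HermitianMetric Γ J) :
    ¬ h.IsSKT := by
  intro hskt
  set a := b + starRingEnd ℂ c with ha
  have hω := h.contDiff_fundForm hJ.smooth
  have hωinv := h.fundForm_isInvForm hJ.invariant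
  have hδ : ContDiff ℝ ∞ (delbar J 1 1 h.fundForm) :=
    contDiff_typePart hJ.smooth (contDiff_extDeriv hω)
  have hδinv : IsInvForm Γ (delbar J 1 1 h.fundForm) :=
    IsInvForm.typePart hJ.invariant (hωinv.extDeriv hω)
  have hs1 : ContDiff ℝ ∞ fun z => pairWedge (φ j z) (delbar J 1 1 h.fundForm z) :=
    contDiff_pairWedge (hφ.smooth j) hδ
  have hs2 : ContDiff ℝ ∞ fun z => covWedge (φ 0 z) (pairWedge (φ j z) (h.fundForm z)) :=
    contDiff_covWedge (hφ.smooth 0) (contDiff_pairWedge (hφ.smooth j) hω)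
  have hs3 : ContDiff ℝ ∞ fun z => ((w j : ℂ) * a) •
      covWedge (φ 0 z) (pairWedge (φ j z) (h.fundForm z)) := hs2.const_smul _
  let τ : Form 5 := fun z => pairWedge (φ j z) (delbar J 1 1 h.fundForm z) +
    ((w j : ℂ) * a) • covWedge (φ 0 z) (pairWedge (φ j z) (h.fundForm z))
  have hτ : ContDiff ℝ ∞ τ := hs1.add hs3
  have hτinv : IsInvForm Γ τ := by
    intro x hx z
    have h1 := isInvForm_pairWedge (hinv j) hδinv x hx z
    have h2 := isInvForm_covWedge (hinv 0) (isInvForm_pairWedge (hinv j) hωinv) x hx z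
    exact congrArg₂ (fun α β : Alt 5 => α + ((w j : ℂ) * a) • β) h1 h2
  have hd0 : ∀ z, pairWedge (φ j z) (extDeriv (delbar J 1 1 h.fundForm) z) = 0 := by
    intro z
    rw [← hφ.pairWedge_typePart z]
    have : typePart (J z) 2 2 (extDeriv (delbar J 1 1 h.fundForm) z) = 0 := hskt z
    exact (congrArg (pairWedge (φ j z)) this).trans (pairWedge_zero _)
  have hdτ : ∀ z, extDeriv τ z = -((‖a‖ ^ 2 : ℝ) : ℂ) •
      pairWedge (φ 0 z) (pairWedge (φ j z) (h.fundForm z)) := by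
    intro z
    have h1 := hφ.extDeriv_obstructing ho hδ z
    rw [hd0] at h1
    have h2 : covWedge (φ 0 z) (pairWedge (φ j z) (delbar J 1 1 h.fundForm z)) =
      covWedge (φ 0 z) (pairWedge (φ j z) (extDeriv h.fundForm z)) :=
      hφ.covWedge_pairWedge_typePart z _
    have h3 : covWedge (conjCov (φ 0 z)) (pairWedge (φ j z) (delbar J 1 1 h.fundForm z)) = 0 :=
      hφ.conj_covWedge_pairWedge_typePart z _
    rw [h2, h3] at h1
    have h4 := hφ.extDeriv_zero_obstructing ho hω z
    have h5 : extDeriv τ z = extDeriv (fun z => pairWedge (φ j z) (delbar J 1 1 h.fundForm z)) z +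
        ((w j : ℂ) * a) • extDeriv
          (fun z => covWedge (φ 0 z) (pairWedge (φ j z) (h.fundForm z))) z := by
      rw [← extDeriv_const_smul_form _ (hs2.differentiable (by simp) z)]
      exact extDeriv_fun_add (hs1.differentiable (by simp) z) (hs3.differentiable (by simp) z)
    rw [h5, h1, h4]
    have hw : (w j : ℂ) ^ 2 = 1 := by exact_mod_cast ho.sq_weight
    have hn : a * starRingEnd ℂ a = ((‖a‖ ^ 2 : ℝ) : ℂ) := by
      rw [Complex.mul_conj']; push_cast; rfl
    ext v
    simp only [ContinuousAlternatingMap.add_apply, ContinuousAlternatingMap.smul_apply,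
      ContinuousAlternatingMap.sub_apply, ContinuousAlternatingMap.coe_zero, Pi.zero_apply,
      smul_eq_mul, ← ha, ← hn]
    linear_combination -(a * starRingEnd ℂ a *
      pairWedge (φ 0 z) (pairWedge (φ j z) (h.fundForm z)) v) * hw
  obtain ⟨e, he⟩ := h.exists_volume hφ ho.ne_zero
  choose r hr0 hr using he
  obtain ⟨z, hz⟩ := exists_extDeriv_eq_zero (Γ := Γ) hτ hτinv e (r := fun z => -(‖a‖ ^ 2 * r z))
    fun z => by
      rw [hdτ]
      refine (congrArg (fun x : ℂ => -((‖a‖ ^ 2 : ℝ) : ℂ) * x) (hr z)).trans ?_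
      push_cast; ring
  have ha0 : ‖a‖ ≠ 0 := norm_ne_zero_iff.2 ho.add_ne_zero
  exact hr0 z (by simpa [ha0] using hz)

end

/-! ### The deformed complex structures -/

section

variable {Γ : Subgroup G} {J : EndField} {φ : Fin 3 → E → E →L[ℝ] ℂ} {w : Fin 3 → ℝ}

section Abstract

lemma IsWeightedFrame.linearIndependent (hφ : IsWeightedFrame J φ w) (z : E) :
    LinearIndependent ℂ fun i => φ i z := by
  rw [Fintype.linearIndependent_iff]
  intro g hg i
  obtain ⟨v, hv⟩ := LinearMap.surjective_of_injective
    (f := ((ContinuousLinearMap.pi fun i => φ i z : E →L[ℝ] E) : E →ₗ[ℝ] E))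
    (hφ.frame_injective z) (Pi.single i 1)
  have hv' : ∀ l, φ l z v = (Pi.single i 1 : E) l := fun l => congrFun hv l
  have := DFunLike.congr_fun hg v
  simpa [_root_.sum_apply, hv', Pi.single_apply] using this

/-- The functions `ζᵢ` are holomorphic coordinates. -/
lemma IsWeightedFrame.exists_coordinates (hφ : IsWeightedFrame J φ w) (z : E) :
    ∃ ζ : E → E, ContDiffAt ℝ ∞ ζ z ∧ Function.Bijective (fderiv ℝ ζ z) ∧
      ∀ᶠ y in nhds z, ∀ v, fderiv ℝ ζ y (J y v) = Complex.I • fderiv ℝ ζ y v := by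
  choose ζ hζ h using hφ.exact_mul
  have hd : ∀ y v i, fderiv ℝ (fun y i => ζ i y) y v i = fderiv ℝ (ζ i) y v := by
    intro y v i
    rw [fderiv_pi fun i => (hζ i).differentiable (by simp) y]
    rfl
  refine ⟨fun y i => ζ i y, (contDiff_pi.2 hζ).contDiffAt, ?_, Filter.Eventually.of_forall ?_⟩
  · have hinj : Function.Injective (fderiv ℝ (fun y i => ζ i y) z) := by
      rw [injective_iff_map_eq_zero]
      intro v hv
      refine hφ.eq_zero z v fun i => ?_
      rw [h, _root_.smul_apply, ← hd, hv]
      simp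
    exact ⟨hinj, LinearMap.surjective_of_injective
      (f := (fderiv ℝ (fun y i => ζ i y) z : E →ₗ[ℝ] E)) hinj⟩
  · intro y v
    funext i
    have h1 := hφ.type_one_zero i y v
    rw [h, _root_.smul_apply, _root_.smul_apply] at h1
    rw [Pi.smul_apply, hd, hd]
    refine mul_left_cancel₀ (Complex.exp_ne_zero (w i * y 0)) ?_
    simp only [smul_eq_mul] at h1 ⊢
    rw [h1]; ring

end Abstract

section Beltrami

/-- The coefficients `1, e^{z₁}, e^{-z₁}` of the left-invariant coframe. -/
def coefP (z : E) : Fin 3 → ℂ := ![1, Complex.exp (z 0), Complex.exp (-(z 0))]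

lemma coefP_ne_zero (z : E) (i : Fin 3) : coefP z i ≠ 0 := by
  fin_cases i <;> simp [coefP, Complex.exp_ne_zero]

lemma contDiff_coefP (i : Fin 3) : ContDiff ℝ ∞ fun z => coefP z i := by
  fin_cases i <;> simp [coefP] <;> fun_prop

lemma phi_apply (i : Fin 3) (z v : E) : phi i z v = coefP z i * v i := rfl

lemma phiTilde_apply (l : Fin 3) (z v : E) :
    phiTilde l z v = coefP z l * starRingEnd ℂ (v l) := by
  fin_cases l <;> simp [phiTilde, phi, coefP, ← Complex.exp_conj, ← mul_assoc, ← Complex.exp_add]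
  left; congr 1; ring

lemma theta_eq (i : Fin 3) (z : E) : theta i z = Pi.single i (coefP z i)⁻¹ := by
  rw [theta]
  congr 1
  fin_cases i <;> simp [coefP, Complex.exp_neg]

variable {t : Matrix (Fin 3) (Fin 3) ℂ}

lemma beltrami_apply (t : Matrix (Fin 3) (Fin 3) ℂ) (z v : E) (i : Fin 3) :
    beltrami t z v i =
      v i + (coefP z i)⁻¹ * ∑ l, t i l * (coefP z l * starRingEnd ℂ (v l)) := by
  simp only [beltrami, psi, _root_.add_apply, ContinuousLinearMap.id_apply,
    _root_.sum_apply, ContinuousLinearMap.smulRight_apply, phiTilde_apply, theta_eq, Pi.add_apply,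
    Finset.sum_apply, Pi.smul_apply, Pi.single_apply, smul_eq_mul]
  rw [Finset.sum_eq_single i (by intro b _ hb; simp [hb.symm]) (by simp)]
  simp only [if_true, Finset.mul_sum]
  congr 1
  exact Finset.sum_congr rfl fun l _ => by ring

lemma phiT_apply (t : Matrix (Fin 3) (Fin 3) ℂ) (i : Fin 3) (z v : E) :
    phiT t i z v = coefP z i * v i + ∑ l, t i l * (coefP z l * starRingEnd ℂ (v l)) := by
  rw [phiT, ContinuousLinearMap.comp_apply, phi_apply, beltrami_apply, mul_add, ← mul_assoc,
    mul_inv_cancel₀ (coefP_ne_zero z i), one_mul]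

lemma contDiff_beltrami (t : Matrix (Fin 3) (Fin 3) ℂ) : ContDiff ℝ ∞ (beltrami t) := by
  rw [contDiff_clm_apply_iff]
  intro v
  rw [contDiff_pi]
  intro i
  simp only [beltrami_apply]
  refine contDiff_const.add (ContDiff.mul ?_ (ContDiff.sum fun l _ => ?_))
  · exact (contDiff_coefP i).inv fun z => coefP_ne_zero z i
  · exact contDiff_const.mul ((contDiff_coefP l).mul contDiff_const)

lemma contDiff_phiT (t : Matrix (Fin 3) (Fin 3) ℂ) (i : Fin 3) : ContDiff ℝ ∞ (phiT t i) := by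
  rw [contDiff_clm_apply_iff]
  intro v
  simp only [phiT_apply]
  refine ((contDiff_coefP i).mul contDiff_const).add (ContDiff.sum fun l _ => ?_)
  exact contDiff_const.mul ((contDiff_coefP l).mul contDiff_const)

/-- In the left-invariant frame, `1 + ψ(t)` is a small perturbation of the identity, uniformly on
`G`. -/
lemma phiT_eq_zero (ht : ∀ i l, ‖t i l‖ < 1 / 6) {z v : E} (h : ∀ i, phiT t i z v = 0) :
    v = 0 := by
  let u : E := fun i => coefP z i * v i
  have hu : ‖u‖ ≤ 1 / 2 * ‖u‖ := by
    rw [pi_norm_le_iff_of_nonneg (by positivity)]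
    intro i
    have h1 := h i
    rw [phiT_apply] at h1
    have h2 : u i = -∑ l, t i l * (coefP z l * starRingEnd ℂ (v l)) :=
      eq_neg_of_add_eq_zero_left h1
    rw [h2, norm_neg]
    refine (norm_sum_le _ _).trans ?_
    have h3 : ∀ l ∈ Finset.univ, ‖t i l * (coefP z l * starRingEnd ℂ (v l))‖ ≤ 1 / 6 * ‖u‖ := by
      intro l _
      rw [norm_mul, norm_mul, RCLike.norm_conj, ← norm_mul]
      exact mul_le_mul (ht i l).le (norm_le_pi_norm u l) (norm_nonneg _) (by norm_num)
    -- A row has three entries, each smaller than `1 / 6`.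
    refine (Finset.sum_le_sum h3).trans ?_
    rw [Finset.sum_const, Finset.card_univ, Fintype.card_fin, nsmul_eq_mul]
    push_cast
    linarith
  have hu0 : u = 0 := norm_eq_zero.1 (le_antisymm (by linarith) (norm_nonneg _))
  funext i
  exact (mul_eq_zero.1 (congrFun hu0 i)).resolve_left (coefP_ne_zero z i)

lemma beltrami_isInvertible (ht : ∀ i l, ‖t i l‖ < 1 / 6) (z : E) :
    (beltrami t z).IsInvertible := by
  have hinj : Function.Injective (beltrami t z : E →ₗ[ℝ] E) := by
    rw [injective_iff_map_eq_zero]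
    intro v hv
    refine phiT_eq_zero ht (z := z) fun i => ?_
    have hv' : beltrami t z v = 0 := hv
    rw [phiT, ContinuousLinearMap.comp_apply, hv', map_zero]
  exact ⟨(LinearEquiv.ofInjectiveEndo _ hinj).toContinuousLinearEquiv, by ext v; rfl⟩

lemma beltrami_deformedJ (ht : ∀ i l, ‖t i l‖ < 1 / 6) (z v : E) :
    beltrami t z (deformedJ t z v) = Complex.I • beltrami t z v := by
  have h := (beltrami_isInvertible ht z).self_comp_inverse
  exact DFunLike.congr_fun h (Complex.I • beltrami t z v)

lemma phiT_deformedJ (ht : ∀ i l, ‖t i l‖ < 1 / 6) (i : Fin 3) (z v : E) :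
    phiT t i z (deformedJ t z v) = Complex.I * phiT t i z v := by
  rw [phiT, ContinuousLinearMap.comp_apply, ContinuousLinearMap.comp_apply,
    beltrami_deformedJ ht, phi_apply, phi_apply, Pi.smul_apply, smul_eq_mul]
  ring

lemma contDiff_deformedJ (ht : ∀ i l, ‖t i l‖ < 1 / 6) : ContDiff ℝ ∞ (deformedJ t) := by
  have h1 : ContDiff ℝ ∞ fun z => (beltrami t z).inverse := by
    rw [contDiff_iff_contDiffAt]
    intro z
    obtain ⟨e, he⟩ := beltrami_isInvertible ht z
    have h2 := contDiffAt_map_inverse (𝕜 := ℝ) (n := ∞) e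
    rw [he] at h2
    exact h2.comp z (contDiff_beltrami t).contDiffAt
  exact h1.clm_comp ((contDiff_beltrami t).const_smul Complex.I)

lemma deformedJ_sq (ht : ∀ i l, ‖t i l‖ < 1 / 6) (z v : E) :
    deformedJ t z (deformedJ t z v) = -v := by
  rw [← sub_eq_zero, sub_neg_eq_add]
  refine phiT_eq_zero ht (z := z) fun i => ?_
  rw [map_add, phiT_deformedJ ht, phiT_deformedJ ht]
  linear_combination phiT t i z v * Complex.I_sq

/-- The forms `φⁱ + ψ(t) ⌟ φⁱ` descend to `Γ \ G`, because `e^{z₁ - z̄₁}` does. -/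
lemma phiT_leftMul (hΓ : IsNakamuraLattice Γ) (t : Matrix (Fin 3) (Fin 3) ℂ) (i : Fin 3) {a : G}
    (ha : a ∈ Γ) (z : E) : (phiT t i (leftMul a z)).comp (leftLin a) = phiT t i z := by
  have h1 : Complex.exp (a 0) = Complex.exp (starRingEnd ℂ (a 0)) := by
    have := hΓ.exp_eq_one a ha
    rwa [Complex.exp_sub, div_eq_one_iff_eq (Complex.exp_ne_zero _)] at this
  have h2 : ∀ l (v : E), coefP (leftMul a z) l * leftLin a v l = coefP z l * v l := by
    intro l v
    have h3 : Complex.exp (a 0) ≠ 0 := Complex.exp_ne_zero _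
    fin_cases l <;> simp [coefP, leftMul, leftLin, Complex.exp_add, Complex.exp_neg] <;> field_simp
  have h4 : ∀ l (v : E), coefP (leftMul a z) l * starRingEnd ℂ (leftLin a v l) =
      coefP z l * starRingEnd ℂ (v l) := by
    intro l v
    have h3 : Complex.exp (starRingEnd ℂ (a 0)) ≠ 0 := Complex.exp_ne_zero _
    fin_cases l <;> simp [coefP, leftMul, leftLin, Complex.exp_add, Complex.exp_neg,
      ← Complex.exp_conj, h1] <;> field_simp
  ext v
  rw [ContinuousLinearMap.comp_apply, phiT_apply, phiT_apply, h2]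
  simp only [h4]

lemma deformedJ_isInvariant (hΓ : IsNakamuraLattice Γ) (ht : ∀ i l, ‖t i l‖ < 1 / 6) :
    IsInvariant Γ (deformedJ t) := by
  intro a ha z
  rw [dLeft_eq a z]
  ext1 v
  rw [← sub_eq_zero]
  refine phiT_eq_zero ht (z := leftMul a z) fun i => ?_
  have h := fun u => DFunLike.congr_fun (phiT_leftMul hΓ t i ha z) u
  simp only [ContinuousLinearMap.comp_apply] at h ⊢
  rw [map_sub, phiT_deformedJ ht, h, h, phiT_deformedJ ht, sub_self]

/-- If the first row and the `m`-th row of `t` vanish outside the `m`-th column, where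
`t_{1m} ≠ 0`, then `J_t` is not left-invariant: the forms `φ_t¹` at `z₁ = 0` and `z₁ = iπ/2` would
make both `φᵐ` and its conjugate forms of type `(1,0)`. -/
lemma deformedJ_not_isLeftInvariant (ht : ∀ i l, ‖t i l‖ < 1 / 6) {m : Fin 3} (hm : m ≠ 0)
    (h0 : t 0 m ≠ 0) (h1 : ∀ l, l ≠ m → t 0 l = 0) (h2 : ∀ l, l ≠ m → t m l = 0) :
    ¬ IsLeftInvariant (deformedJ t) := by
  intro hJ
  have key : ∀ (i : Fin 3) (y v : E), phiT t i y (leftLin y (deformedJ t 0 v)) =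
      Complex.I * phiT t i y (leftLin y v) := by
    intro i y v
    have h := DFunLike.congr_fun (hJ y (Subgroup.mem_top _) 0) v
    have hy : leftMul y 0 = y := by
      rw [leftMul_eq y, map_zero, add_zero]
    rw [dLeft_eq y, hy] at h
    simp only [ContinuousLinearMap.comp_apply] at h
    rw [← h, phiT_deformedJ ht]
  have hrow : ∀ (i : Fin 3), (∀ l, l ≠ m → t i l = 0) → ∀ y v : E, phiT t i y v =
      coefP y i * v i + t i m * (coefP y m * starRingEnd ℂ (v m)) := by
    intro i hi y v
    rw [phiT_apply, Finset.sum_eq_single m (fun l _ hl => by rw [hi l hl, zero_mul]) (by simp)]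
  let y : E := fun _ => Real.pi / 2 * Complex.I
  have hy : ∀ v : E, coefP y m * starRingEnd ℂ (leftLin y v m) = -starRingEnd ℂ (v m) := by
    intro v
    have e1 : Complex.exp (Real.pi / 2 * Complex.I) = Complex.I := Complex.exp_pi_div_two_mul_I
    have e2 : Complex.exp (-(Real.pi / 2 * Complex.I)) = -Complex.I := by
      rw [Complex.exp_neg, e1, Complex.inv_I]
    have e3 : Complex.I * (Complex.I * starRingEnd ℂ (v m)) = -starRingEnd ℂ (v m) := by
      linear_combination starRingEnd ℂ (v m) * Complex.I_sq
    fin_cases m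
    · exact absurd rfl hm
    · simpa [y, coefP, leftLin, e1, e2] using e3
    · simpa [y, coefP, leftLin, e1, e2] using e3
  have hz : ∀ (v : E) (l : Fin 3), leftLin 0 v l = v l := by
    intro v l; fin_cases l <;> simp [leftLin]
  have hc0 : ∀ l, coefP 0 l = 1 := by intro l; fin_cases l <;> simp [coefP]
  have hl0 : ∀ v : E, coefP y 0 * leftLin y v 0 = v 0 := by
    intro v; simp [coefP, leftLin]
  let v : E := Pi.single m 1
  have k1 := key 0 y v
  have k2 := key 0 0 v
  have k3 := key m 0 v
  rw [hrow 0 h1, hrow 0 h1, hy, hy, hl0, hl0] at k1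
  rw [hrow 0 h1, hrow 0 h1] at k2
  rw [hrow m h2, hrow m h2] at k3
  simp only [hz, hc0, one_mul] at k2 k3
  have k4 : starRingEnd ℂ (deformedJ t 0 v m) = Complex.I * starRingEnd ℂ (v m) := by
    refine mul_left_cancel₀ (mul_ne_zero two_ne_zero h0) ?_
    linear_combination k2 - k1
  have k5 := congrArg (starRingEnd ℂ) k4
  simp only [Complex.conj_conj, map_mul, Complex.conj_I] at k5
  have hv : v m = 1 := by simp [v]
  rw [k4, k5, hv] at k3
  simp only [map_one, mul_one] at k3
  have : (2 : ℂ) * Complex.I = 0 := by linear_combination -k3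
  simp at this

end Beltrami

end

/-! ### The coframes adapted to the three classes -/

section

variable {Γ : Subgroup G} {t : Matrix (Fin 3) (Fin 3) ℂ}

/-- The primitive is `ζ = α zᵢ + β z̄ₗ + γ e^{s z₁}`. All the members of the adapted coframes have
this form. -/
lemma exists_primitive {θ : E → E →L[ℝ] ℂ} {r : ℝ} (i l : Fin 3) (α β γ s : ℂ)
    (h : ∀ z v, θ z v = Complex.exp (r * z 0) *
      (α * v i + β * starRingEnd ℂ (v l) + γ * (Complex.exp (s * z 0) * (s * v 0)))) :
    ∃ ζ : E → ℂ, ContDiff ℝ ∞ ζ ∧ ∀ z, θ z = Complex.exp (r * z 0) • fderiv ℝ ζ z := by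
  have hp : ∀ (m : Fin 3) (z : E), HasFDerivAt (fun y : E => y m)
      (ContinuousLinearMap.proj m : E →L[ℝ] ℂ) z := fun m z =>
    (ContinuousLinearMap.proj m : E →L[ℝ] ℂ).hasFDerivAt
  have hc : ∀ z : E, HasFDerivAt (fun y : E => starRingEnd ℂ (y l))
      (conjCov (ContinuousLinearMap.proj l : E →L[ℝ] ℂ)) z := fun z =>
    (conjCov (ContinuousLinearMap.proj l : E →L[ℝ] ℂ)).hasFDerivAt
  refine ⟨fun z => α * z i + β * starRingEnd ℂ (z l) + γ * Complex.exp (s * z 0), ?_, ?_⟩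
  · have hc' : ContDiff ℝ ∞ fun y : E => starRingEnd ℂ (y l) :=
      (conjCov (ContinuousLinearMap.proj l : E →L[ℝ] ℂ)).contDiff
    fun_prop
  · intro z
    have hd := (((hp i z).const_mul α).add ((hc z).const_mul β)).add
      (((hp 0 z).const_mul s).cexp.const_mul γ)
    refine Eq.trans ?_ (congrArg (Complex.exp (r * z 0) • ·) hd.fderiv.symm)
    ext v
    rw [h]
    simp
    ring

/-- The weights of the adapted coframes. -/
def DefClass.weight : DefClass → Fin 3 → ℝ
  | .one => ![0, 1, -1]
  | .three => ![1, 1, -1]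
  | .four => ![-1, 1, -1]

lemma DefClass.shift_zero (c : DefClass) (t : Matrix (Fin 3) (Fin 3) ℂ) : c.shift t 0 = 0 := by
  cases c <;> rfl

lemma DefClass.coframe_apply (c : DefClass) (t : Matrix (Fin 3) (Fin 3) ℂ) (i : Fin 3) (z v : E) :
    c.coframe t i z v = phiT t i z v - c.shift t i * phiT t 0 z v := rfl

lemma DefClass.coframe_zero (c : DefClass) (t : Matrix (Fin 3) (Fin 3) ℂ) (z : E) :
    c.coframe t 0 z = phiT t 0 z := by
  ext v
  rw [c.coframe_apply, c.shift_zero, zero_mul, sub_zero]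

lemma DefClass.exists_primitive_coframe {c : DefClass} (hc : c.Mem t) (i : Fin 3) :
    ∃ ζ : E → ℂ, ContDiff ℝ ∞ ζ ∧
      ∀ z, c.coframe t i z = Complex.exp (c.weight i * z 0) • fderiv ℝ ζ z := by
  have he : ∀ z : E, Complex.exp (z 0) ≠ 0 := fun z => Complex.exp_ne_zero _
  cases c with
  | one =>
    obtain ⟨h0, h1, h2, h3, h4⟩ := hc
    fin_cases i
    · refine exists_primitive 0 0 1 (t 0 0) 0 0 fun z v => ?_
      simp [coframe_apply, phiT_apply, Fin.sum_univ_three, coefP, shift, weight, *]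
    · refine exists_primitive 1 1 1 (t 1 1) (t 1 0 / t 0 0) (-1) fun z v => ?_
      have := he z
      simp [coframe_apply, phiT_apply, Fin.sum_univ_three, coefP, shift, weight, Complex.exp_neg, *]
      field_simp
      ring
    · refine exists_primitive 2 2 1 (t 2 2) (-(t 2 0 / t 0 0)) 1 fun z v => ?_
      have := he z
      simp [coframe_apply, phiT_apply, Fin.sum_univ_three, coefP, shift, weight, Complex.exp_neg, *]
      field_simp
      ring
  | three =>
    obtain ⟨h0, h1, h2, h3, h4, h5⟩ := hc
    fin_cases i
    · refine exists_primitive 0 1 0 (t 0 1) (-1) (-1) fun z v => ?_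
      have := he z
      simp [coframe_apply, phiT_apply, Fin.sum_univ_three, coefP, shift, weight, Complex.exp_neg, *]
      field_simp
      ring
    · refine exists_primitive 1 1 1 (t 1 1) 0 0 fun z v => ?_
      simp [coframe_apply, phiT_apply, Fin.sum_univ_three, coefP, shift, weight, *]
      ring
    · refine exists_primitive 2 2 1 (t 2 2) (-(t 2 1 / t 0 1)) 1 fun z v => ?_
      have := he z
      simp [coframe_apply, phiT_apply, Fin.sum_univ_three, coefP, shift, weight, Complex.exp_neg, *]
      field_simp
      ring
  | four =>
    obtain ⟨h0, h1, h2, h3, h4, h5⟩ := hc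
    fin_cases i
    · refine exists_primitive 0 2 0 (t 0 2) 1 1 fun z v => ?_
      have := he z
      simp [coframe_apply, phiT_apply, Fin.sum_univ_three, coefP, shift, weight, Complex.exp_neg, *]
      field_simp
      ring
    · refine exists_primitive 1 1 1 (t 1 1) (t 1 2 / t 0 2) (-1) fun z v => ?_
      have := he z
      simp [coframe_apply, phiT_apply, Fin.sum_univ_three, coefP, shift, weight, Complex.exp_neg, *]
      field_simp
      ring
    · refine exists_primitive 2 2 1 (t 2 2) 0 0 fun z v => ?_
      simp [coframe_apply, phiT_apply, Fin.sum_univ_three, coefP, shift, weight, *]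
      ring

lemma DefClass.isWeightedFrame {c : DefClass} (ht : ∀ i l, ‖t i l‖ < 1 / 6) (hc : c.Mem t) :
    IsWeightedFrame (deformedJ t) (c.coframe t) c.weight where
  smooth i := (contDiff_phiT t i).sub ((contDiff_phiT t 0).const_smul _)
  type_one_zero i z v := by
    rw [c.coframe_apply, c.coframe_apply, phiT_deformedJ ht, phiT_deformedJ ht]
    ring
  eq_zero z v h := by
    have h0 : phiT t 0 z v = 0 := by rw [← c.coframe_zero]; exact h 0
    refine phiT_eq_zero ht (z := z) fun i => ?_
    have hi := h i
    rwa [c.coframe_apply, h0, mul_zero, sub_zero] at hi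
  exact_mul := exists_primitive_coframe hc

lemma DefClass.coframe_invariant (c : DefClass) (hΓ : IsNakamuraLattice Γ)
    (t : Matrix (Fin 3) (Fin 3) ℂ) (i : Fin 3) {a : G} (ha : a ∈ Γ) (z : E) :
    (c.coframe t i (leftMul a z)).comp (dLeft a z) = c.coframe t i z := by
  rw [dLeft_eq a z]
  ext v
  have h := fun l => DFunLike.congr_fun (phiT_leftMul hΓ t l ha z) v
  simp only [ContinuousLinearMap.comp_apply] at h
  rw [ContinuousLinearMap.comp_apply, coframe_apply, coframe_apply, h, h]

lemma one_sub_mul_conj_ne_zero {x : ℂ} (hx : ‖x‖ < 1 / 6) : 1 - x * starRingEnd ℂ x ≠ 0 := by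
  intro h
  have h1 := congrArg norm (sub_eq_zero.1 h)
  rw [norm_mul, RCLike.norm_conj, norm_one] at h1
  nlinarith [norm_nonneg x]

/-- `φ_t¹ = dz₁ + t₁₁ dz̄₁` in class (1). -/
lemma dz_eq_of_one (ht : ∀ i l, ‖t i l‖ < 1 / 6) (hc : DefClass.one.Mem t) (z : E) :
    dz = (1 - t 0 0 * starRingEnd ℂ (t 0 0))⁻¹ • DefClass.one.coframe t 0 z +
      (-t 0 0 / (1 - t 0 0 * starRingEnd ℂ (t 0 0))) • conjCov (DefClass.one.coframe t 0 z) := by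
  obtain ⟨h0, h1, h2, h3, h4⟩ := hc
  have hN := one_sub_mul_conj_ne_zero (ht 0 0)
  ext v
  rw [DefClass.coframe_zero]
  simp [dz, phiT_apply, Fin.sum_univ_three, coefP, h1, h2]
  field_simp
  ring

/-- In class (3) the form `φ̄²` occurring in `φ_t¹ = dz₁ + t₁₂ e^{z₁ - z̄₁} φ̄²` is a combination of
`φ_t²` and its conjugate. -/
lemma dz_eq_of_three (ht : ∀ i l, ‖t i l‖ < 1 / 6) (hc : DefClass.three.Mem t) (z : E) :
    ∃ m n : ℂ, dz = DefClass.three.coframe t 0 z +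
      m • DefClass.three.coframe t 1 z + n • conjCov (DefClass.three.coframe t 1 z) := by
  obtain ⟨h0, h1, h2, h3, h4, h5⟩ := hc
  have hN := one_sub_mul_conj_ne_zero (ht 1 1)
  rw [mul_comm] at hN
  have he : Complex.exp (starRingEnd ℂ (z 0)) ≠ 0 := Complex.exp_ne_zero _
  refine ⟨t 0 1 * starRingEnd ℂ (t 1 1) / (1 - starRingEnd ℂ (t 1 1) * t 1 1),
    -(t 0 1 * (Complex.exp (z 0) / Complex.exp (starRingEnd ℂ (z 0)))) /
      (1 - starRingEnd ℂ (t 1 1) * t 1 1), ?_⟩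
  ext v
  rw [DefClass.coframe_zero]
  simp [dz, DefClass.coframe_apply, DefClass.shift, phiT_apply, Fin.sum_univ_three, coefP,
    ← Complex.exp_conj, h1, h2, h3, h4]
  field_simp
  ring

/-- In class (4) the form `φ̄³` occurring in `φ_t¹ = dz₁ + t₁₃ e^{z̄₁ - z₁} φ̄³` is a combination of
`φ_t³` and its conjugate. -/
lemma dz_eq_of_four (ht : ∀ i l, ‖t i l‖ < 1 / 6) (hc : DefClass.four.Mem t) (z : E) :
    ∃ m n : ℂ, dz = DefClass.four.coframe t 0 z +
      m • DefClass.four.coframe t 2 z + n • conjCov (DefClass.four.coframe t 2 z) := by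
  obtain ⟨h0, h1, h2, h3, h4, h5⟩ := hc
  have hN := one_sub_mul_conj_ne_zero (ht 2 2)
  rw [mul_comm] at hN
  have he : Complex.exp (starRingEnd ℂ (z 0)) ≠ 0 := Complex.exp_ne_zero _
  have he' : Complex.exp (z 0) ≠ 0 := Complex.exp_ne_zero _
  refine ⟨t 0 2 * starRingEnd ℂ (t 2 2) / (1 - starRingEnd ℂ (t 2 2) * t 2 2),
    -(t 0 2 * (Complex.exp (starRingEnd ℂ (z 0)) / Complex.exp (z 0))) /
      (1 - starRingEnd ℂ (t 2 2) * t 2 2), ?_⟩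
  ext v
  rw [DefClass.coframe_zero]
  simp [dz, DefClass.coframe_apply, DefClass.shift, phiT_apply, Fin.sum_univ_three, coefP,
    ← Complex.exp_conj, Complex.exp_neg, h1, h2, h4, h5]
  field_simp
  ring

lemma DefClass.exists_isObstructing {c : DefClass} (ht : ∀ i l, ‖t i l‖ < 1 / 6)
    (hc : c.Mem t) : ∃ x y : ℂ, IsObstructing (c.coframe t) c.weight c.obstructionIndex x y := by
  cases c with
  | one =>
    refine ⟨(1 - t 0 0 * starRingEnd ℂ (t 0 0))⁻¹,
      -t 0 0 / (1 - t 0 0 * starRingEnd ℂ (t 0 0)), by decide, by simp [weight, obstructionIndex],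
      ?_, by simp [weight], fun z => ⟨0, 0, ?_⟩⟩
    · have hN := one_sub_mul_conj_ne_zero (ht 0 0)
      have h1 : (1 : ℂ) - starRingEnd ℂ (t 0 0) ≠ 0 := by
        intro h
        have h1 := congrArg norm (sub_eq_zero.1 h)
        rw [RCLike.norm_conj, norm_one] at h1
        linarith [ht 0 0]
      have h2 : (1 - t 0 0 * starRingEnd ℂ (t 0 0))⁻¹ + starRingEnd ℂ
          (-t 0 0 / (1 - t 0 0 * starRingEnd ℂ (t 0 0))) =
          (1 - starRingEnd ℂ (t 0 0)) / (1 - t 0 0 * starRingEnd ℂ (t 0 0)) := by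
        rw [map_div₀, map_sub, map_mul, map_neg, map_one, Complex.conj_conj,
          mul_comm (starRingEnd ℂ (t 0 0))]
        ring
      rw [h2]
      exact div_ne_zero h1 hN
    · refine (dz_eq_of_one ht hc z).trans ?_
      ext v
      simp
  | three =>
    refine ⟨1, 0, by decide, by simp [weight, obstructionIndex], by simp, by simp, fun z => ?_⟩
    obtain ⟨m, n, h⟩ := dz_eq_of_three ht hc z
    refine ⟨m, n, h.trans ?_⟩
    ext v
    simp [obstructionIndex]
  | four =>
    refine ⟨1, 0, by decide, by simp [weight, obstructionIndex], by simp, by simp, fun z => ?_⟩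
    obtain ⟨m, n, h⟩ := dz_eq_of_four ht hc z
    refine ⟨m, n, h.trans ?_⟩
    ext v
    simp [obstructionIndex]

lemma isBalancing_of_lt {φ : Fin 3 → E → E →L[ℝ] ℂ} {w : Fin 3 → ℝ}
    (h : ∀ i j, i < j → w i + w j = 0 ∨ ∀ z, ∃ a b c d : ℂ,
      dz = a • φ i z + b • conjCov (φ i z) + c • φ j z + d • conjCov (φ j z)) :
    IsBalancing φ w := by
  intro i j hij
  rcases lt_or_gt_of_ne hij with hlt | hlt
  · exact h i j hlt
  · refine (h j i hlt).imp (fun h => by rw [add_comm]; exact h) fun h z => ?_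
    obtain ⟨a, b, c, d, h⟩ := h z
    exact ⟨c, d, a, b, by rw [h]; abel⟩

lemma DefClass.isBalancing {c : DefClass} (ht : ∀ i l, ‖t i l‖ < 1 / 6) (hc : c.Mem t) :
    IsBalancing (c.coframe t) c.weight := by
  obtain ⟨x, y, ho⟩ := exists_isObstructing ht hc
  refine isBalancing_of_lt fun i j hij => ?_
  have hcases : (i = 0 ∧ j = 1) ∨ (i = 0 ∧ j = 2) ∨ (i = 1 ∧ j = 2) := by
    revert i j; decide
  cases c with
  | one =>
    have h0 : ∀ j z, ∃ a b c d : ℂ, dz = a • one.coframe t 0 z + b • conjCov (one.coframe t 0 z) +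
        c • one.coframe t j z + d • conjCov (one.coframe t j z) := by
      intro j z
      refine ⟨(1 - t 0 0 * starRingEnd ℂ (t 0 0))⁻¹,
        -t 0 0 / (1 - t 0 0 * starRingEnd ℂ (t 0 0)), 0, 0, (dz_eq_of_one ht hc z).trans ?_⟩
      ext v
      simp
    rcases hcases with ⟨rfl, rfl⟩ | ⟨rfl, rfl⟩ | ⟨rfl, rfl⟩
    · exact Or.inr (h0 1)
    · exact Or.inr (h0 2)
    · left; simp [weight]
  | three =>
    rcases hcases with ⟨rfl, rfl⟩ | ⟨rfl, rfl⟩ | ⟨rfl, rfl⟩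
    · exact Or.inr fun z => ⟨x, y, ho.dz_eq z⟩
    · left; simp [weight]
    · left; simp [weight]
  | four =>
    rcases hcases with ⟨rfl, rfl⟩ | ⟨rfl, rfl⟩ | ⟨rfl, rfl⟩
    · left; simp [weight]
    · exact Or.inr fun z => ⟨x, y, ho.dz_eq z⟩
    · left; simp [weight]

lemma DefClass.not_isLeftInvariant {c : DefClass} (ht : ∀ i l, ‖t i l‖ < 1 / 6) (hc : c.Mem t)
    (h : c = .three ∨ c = .four) : ¬ IsLeftInvariant (deformedJ t) := by
  rcases h with rfl | rfl
  · obtain ⟨h0, h1, h2, h3, h4, h5⟩ := hc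
    refine deformedJ_not_isLeftInvariant ht (m := 1) (by decide) h0 ?_ ?_ <;>
      intro l hl <;> fin_cases l <;> first | assumption | exact absurd rfl hl
  · obtain ⟨h0, h1, h2, h3, h4, h5⟩ := hc
    refine deformedJ_not_isLeftInvariant ht (m := 2) (by decide) h0 ?_ ?_ <;>
      intro l hl <;> fin_cases l <;> first | assumption | exact absurd rfl hl

end

end Nakamura

end

theorem mainTheorem3 (Γ : Subgroup Nakamura.G) (hΓ : IsNakamuraLattice Γ) :
    ∃ ε : ℝ, 0 < ε ∧ ∀ (c : DefClass) (t : Matrix (Fin 3) (Fin 3) ℂ),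
      (∀ i l, ‖t i l‖ < ε) → c.Mem t →
        IsComplexStructure Γ (deformedJ t) ∧
        IsCoframe Γ (deformedJ t) (c.coframe t) ∧
        (∃ h : HermitianMetric Γ (deformedJ t), h.IsDiagonal (c.coframe t) ∧ h.IsBalanced) ∧
        (¬ ∃ h : HermitianMetric Γ (deformedJ t), h.IsSKT) ∧
        (∃ C : ℝ, 0 < C ∧ ∀ z : E,
          delDelbar (deformedJ t)
              (fun y => wedge (oneForm (c.coframe t c.obstructionIndex y))
                (conjForm (oneForm (c.coframe t c.obstructionIndex y)))) z =
            -(C : ℂ) • wedge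
              (wedge (oneForm (c.coframe t 0 z)) (oneForm (c.coframe t c.obstructionIndex z)))
              (conjForm (wedge (oneForm (c.coframe t 0 z))
                (oneForm (c.coframe t c.obstructionIndex z))))) ∧
        (c = DefClass.three ∨ c = DefClass.four → ¬ IsLeftInvariant (deformedJ t)) := by
  have := hΓ.cocompact
  refine ⟨1 / 6, by norm_num, fun c t ht hc => ?_⟩
  have hφ := DefClass.isWeightedFrame ht hc
  have hinv : ∀ i, ∀ a ∈ Γ, ∀ z,
      (c.coframe t i (leftMul a z)).comp (dLeft a z) = c.coframe t i z :=
    fun i a ha z => c.coframe_invariant hΓ t i ha z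
  have hJ : IsComplexStructure Γ (deformedJ t) :=
    ⟨contDiff_deformedJ ht, deformedJ_sq ht, deformedJ_isInvariant hΓ ht, hφ.exists_coordinates⟩
  obtain ⟨x, y, ho⟩ := DefClass.exists_isObstructing ht hc
  refine ⟨hJ, ⟨hφ.smooth, hinv, hφ.type_one_zero, hφ.linearIndependent⟩,
    ⟨hφ.diagonalMetric hinv, hφ.diagonalMetric_isDiagonal hinv,
      hφ.diagonalMetric_isBalanced hinv (DefClass.isBalancing ht hc)⟩,
    fun ⟨h, hskt⟩ => hφ.not_isSKT hinv hJ ho h hskt,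
    ⟨‖x + starRingEnd ℂ y‖ ^ 2, by have := norm_pos_iff.2 ho.add_ne_zero; positivity,
      fun z => hφ.delDelbar_obstructing_wedge ho z⟩,
    DefClass.not_isLeftInvariant ht hc⟩
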